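/- Let $N$ be a von Neumann algebra with a faithful normal state $\varphi$, let $(\sigma_t^{\varphi})_{t\in\mathbf R}$ be its modular automorphism group, and assume that the centralizer $N^{\varphi}=\{x\in N : \varphi(xy)=\varphi(yx)\ \text{for all } y\in N\}$ is a factor. Let $\omega$ be a faithful (normal) state on the matrix algebra $M_n(\mathbf C)$. Call an embedding of von Neumann algebras (an injective normal unital $*$-homomorphism) $\rho : (M_n(\mathbf C),\omega)\hookrightarrow (N,\varphi)$ *modular* if it is state-preserving, $\varphi\circ\rho=\omega$, and its range is globally invariant under the modular group, that is $\sigma_t^{\varphi}(\rho(M_n(\mathbf C)))=\rho(M_n(\mathbf C))$ for all $t\in\mathbf R$. Let $\rho_1,\rho_2 : (M_n(\mathbf C),\omega)\hookrightarrow (N,\varphi)$ be two modular embeddings. Then there exists a unitary $u\in N^{\varphi}$ such that $u\,\rho_1(x)\,u^*=\rho_2(x)$ for all $x\in M_n(\mathbf C)$. -/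

import Mathlib

open scoped ComplexOrder MatrixOrder InnerProductSpace

noncomputable section

/-! ### States on ordered star-algebras and centralizers -/

/-- A positive linear functional that is a faithful state: `φ(1) = 1`, and `φ(x* x) = 0` forces
`x = 0`. -/
structure IsFaithfulState {A : Type*} [Ring A] [StarRing A] [Algebra ℂ A] [PartialOrder A]
    (φ : A →ₚ[ℂ] ℂ) : Prop where
  map_one : φ 1 = 1
  faithful : ∀ x : A, φ (star x * x) = 0 → x = 0

namespace PositiveLinearMap

variable {A : Type*} [CStarAlgebra A] [PartialOrder A] [StarOrderedRing A] (φ : A →ₚ[ℂ] ℂ)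

/-- The centralizer `A^φ = {x | φ(xy) = φ(yx) for all y}` of a positive functional. -/
def stateCentralizer : StarSubalgebra ℂ A where
  carrier := {x | ∀ y, φ (x * y) = φ (y * x)}
  mul_mem' {a b} ha hb y := by
    rw [mul_assoc, ha, mul_assoc, hb, mul_assoc]
  add_mem' {a b} ha hb y := by
    rw [add_mul, mul_add, map_add, map_add, ha, hb]
  algebraMap_mem' r y := by rw [Algebra.commutes]
  star_mem' {a} ha y := by
    have h := congrArg star (ha (star y))
    rw [← map_star φ, ← map_star φ, star_mul, star_mul, star_star] at h
    exact h.symm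

/-! ### The modular automorphism group

`φ.GNS` is Mathlib's GNS Hilbert space `L²(A, φ)`, the completion of `A` for
`⟪a, b⟫ = φ(a* b)`, and `φ.gnsStarAlgHom : A →⋆ₐ[ℂ] (φ.GNS →L[ℂ] φ.GNS)` is the GNS representation
by left multiplication. Let `S` be the closure of the antilinear operator `a ↦ a*` of `φ.GNS`
(with domain the image of `A`) and `Δ = S* S` the modular operator. -/

set_option linter.unusedVariables false in
/-- A type synonym of `A`, which carries the graph inner product of the operator `a ↦ a*`. -/
@[nolint unusedArguments]
def PreDomS (φ : A →ₚ[ℂ] ℂ) := A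

instance : AddCommGroup φ.PreDomS := inferInstanceAs (AddCommGroup A)
instance : Module ℂ φ.PreDomS := inferInstanceAs (Module ℂ A)

/-- The identity map from `A` to its type synonym. -/
def toPreDomS : A ≃ₗ[ℂ] φ.PreDomS := LinearEquiv.refl ℂ _

/-- The identity map from the type synonym to `A`. -/
def ofPreDomS : φ.PreDomS ≃ₗ[ℂ] A := φ.toPreDomS.symm

/-- The graph inner product `⟪a, b⟫_L² + ⟪b*, a*⟫_L² = φ(a* b) + φ(b a*)` of `a ↦ a*`. -/
abbrev preDomSCore : PreInnerProductSpace.Core ℂ φ.PreDomS where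
  inner a b := φ (star (φ.ofPreDomS a) * φ.ofPreDomS b) + φ (φ.ofPreDomS b * star (φ.ofPreDomS a))
  conj_inner_symm a b := by
    rw [map_add, ← Complex.star_def, ← map_star φ, ← map_star φ]
    simp
  re_inner_nonneg a := by
    have h₁ := φ.map_nonneg (star_mul_self_nonneg (φ.ofPreDomS a))
    have h₂ := φ.map_nonneg (mul_star_self_nonneg (φ.ofPreDomS a))
    exact (RCLike.nonneg_iff.mp (add_nonneg h₁ h₂)).1
  add_left a b c := by
    simp only [map_add, star_add, add_mul, mul_add]
    ring
  smul_left a b r := by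
    simp [mul_add]

instance : SeminormedAddCommGroup φ.PreDomS :=
  InnerProductSpace.Core.toSeminormedAddCommGroup (c := φ.preDomSCore)
instance : InnerProductSpace ℂ φ.PreDomS :=
  InnerProductSpace.ofCore φ.preDomSCore

/-- The domain of the closed operator `S` with its graph norm: the completion of `A` for the
norm `‖a‖² = φ(a* a) + φ(a a*)`. -/
abbrev DomS := UniformSpace.Completion φ.PreDomS

/-- The identity of `A`, as a contraction from the graph norm to the GNS norm. -/
def preDomSIncl : φ.PreDomS →L[ℂ] φ.PreGNS :=
  (φ.toPreGNS.toLinearMap ∘ₗ φ.ofPreDomS.toLinearMap).mkContinuous 1 fun a ↦ by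
    have h₂ := φ.map_nonneg (mul_star_self_nonneg (φ.ofPreDomS a))
    rw [one_mul]
    change √(φ (star (φ.ofPreDomS a) * φ.ofPreDomS a)).re ≤
      √(φ (star (φ.ofPreDomS a) * φ.ofPreDomS a) + φ (φ.ofPreDomS a * star (φ.ofPreDomS a))).re
    apply Real.sqrt_le_sqrt
    rw [Complex.add_re]
    have := (RCLike.nonneg_iff.mp h₂).1
    simp only [RCLike.re_to_complex] at this
    linarith

/-- The inclusion `ι : dom S → L²(A, φ)`. -/
def domSIncl : φ.DomS →L[ℂ] φ.GNS := φ.preDomSIncl.completion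

/-- The operator `(1 + Δ)⁻¹ = (1 + S* S)⁻¹` on `L²(A, φ)`, as `ι ι*`, where `ι` is the inclusion of
`dom S` with its graph norm. (`ζ = ι* η` is the vector of `dom S` with
`⟪ζ, ξ⟫ + ⟪S ξ, S ζ⟫ = ⟪η, ξ⟫` for all `ξ` in `dom S`, that is `(1 + Δ) ζ = η`.) -/
def modularResolvent : φ.GNS →L[ℂ] φ.GNS :=
  φ.domSIncl ∘L ContinuousLinearMap.adjoint φ.domSIncl

/-- The unitary `Δ^{it}` on `L²(A, φ)`. With `R = (1 + Δ)⁻¹`, so that `Δ = (1 - R) R⁻¹`, it is the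
bounded operator which satisfies `Δ^{it} R (1 - R) = R^{1 - it} (1 - R)^{1 + it}`, extended by
continuity from the range of `R (1 - R)`. That range is dense, since `R` and `1 - R` are injective,
for a faithful normal state of a von Neumann algebra. The right-hand side is given by the
continuous functional calculus of `R`, whose spectrum lies in `[0, 1]`. -/
def modularUnitary (t : ℝ) : φ.GNS →L[ℂ] φ.GNS :=
  (cfc (fun z : ℂ ↦ z ^ (1 - Complex.I * t) * (1 - z) ^ (1 + Complex.I * t))
      φ.modularResolvent).toLinearMap.extendOfNorm
    (φ.modularResolvent * (1 - φ.modularResolvent)).toLinearMap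

/-- The modular automorphism `σ_t^φ = Ad(Δ^{it})`, acting on the bounded operators of
`L²(A, φ)`; on `A` it acts through the identification of `A` with its image under the (faithful) GNS
representation. -/
def modularAut (t : ℝ) (T : φ.GNS →L[ℂ] φ.GNS) : φ.GNS →L[ℂ] φ.GNS :=
  φ.modularUnitary t * T * φ.modularUnitary (-t)

/-- A subset `B` of `A` is globally invariant under the modular group: `σ_t^φ(B) = B` for all `t`. -/
def IsModularInvariant (B : Set A) : Prop :=
  ∀ t : ℝ, φ.modularAut t '' (φ.gnsStarAlgHom '' B) = φ.gnsStarAlgHom '' B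

end PositiveLinearMap

/-- A modular embedding `ρ : (M_n(ℂ), ω) → (A, φ)`: an injective unital star-homomorphism that is
state-preserving and whose range is globally invariant under the modular group of `φ`.
(Normality is automatic, as `M_n(ℂ)` is finite-dimensional.) -/
structure IsModularEmbedding {A : Type*} [CStarAlgebra A] [PartialOrder A] [StarOrderedRing A]
    {n : ℕ} (ω : Matrix (Fin n) (Fin n) ℂ →ₚ[ℂ] ℂ) (φ : A →ₚ[ℂ] ℂ)
    (ρ : Matrix (Fin n) (Fin n) ℂ →⋆ₐ[ℂ] A) : Prop where
  injective : Function.Injective ρ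
  state_preserving : ∀ x, φ (ρ x) = ω x
  modular_invariant : φ.IsModularInvariant (Set.range ρ)

/-! ### Von Neumann algebras as C⋆-algebras, and normal functionals -/

namespace VonNeumannAlgebra

variable {H : Type*} [NormedAddCommGroup H] [InnerProductSpace ℂ H] [CompleteSpace H]

instance instSMulMemClass : SMulMemClass (VonNeumannAlgebra H) ℂ (H →L[ℂ] H) where
  smul_mem {N} r _ hx := N.toStarSubalgebra.smul_mem hx r

instance isClosed_coe (N : VonNeumannAlgebra H) : IsClosed (N : Set (H →L[ℂ] H)) := by
  rw [← N.centralizer_centralizer]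
  exact Set.isClosed_centralizer _

/-- The order that `N` inherits from the Loewner order of the bounded operators is its order as
a C⋆-algebra. -/
instance instStarOrderedRing (N : VonNeumannAlgebra H) : StarOrderedRing N :=
  StarOrderedRing.of_nonneg_iff'
    (fun {x y} h z ↦ show (z : H →L[ℂ] H) + x ≤ (z : H →L[ℂ] H) + y from add_le_add_right h _)
    fun x ↦ by
      constructor
      · intro h
        have hx : (0 : H →L[ℂ] H) ≤ x := h
        have hmem : cfc Real.sqrt (x : H →L[ℂ] H) ∈ N :=
          cfc_mem (𝕜' := ℂ) (s := N) _ x.2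
        refine ⟨⟨cfc Real.sqrt (x : H →L[ℂ] H), hmem⟩, Subtype.ext ?_⟩
        have hsa : IsSelfAdjoint (cfc Real.sqrt (x : H →L[ℂ] H)) := cfc_predicate _ _
        change (x : H →L[ℂ] H) = star (cfc Real.sqrt (x : H →L[ℂ] H)) *
          (cfc Real.sqrt (x : H →L[ℂ] H) : H →L[ℂ] H)
        rw [hsa.star_eq, ← cfc_mul _ _ _ (by fun_prop) (by fun_prop)]
        conv_lhs => rw [← cfc_id ℝ (x : H →L[ℂ] H)]
        refine cfc_congr fun r hr ↦ ?_
        exact (Real.mul_self_sqrt (spectrum_nonneg_of_nonneg hx hr)).symm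
      · rintro ⟨s, rfl⟩
        exact star_mul_self_nonneg (s : H →L[ℂ] H)

/-- A functional on a von Neumann algebra `N` of operators on `H` is normal if it is ultraweakly
continuous, that is, of the form `x ↦ ∑ₙ ⟪ηₙ, x ξₙ⟫` with square-summable sequences `ξ`, `η`
in `H`. -/
def IsNormal {N : VonNeumannAlgebra H} (φ : N →ₚ[ℂ] ℂ) : Prop :=
  ∃ ξ η : ℕ → H, (Summable fun k ↦ ‖ξ k‖ ^ 2) ∧ (Summable fun k ↦ ‖η k‖ ^ 2) ∧
    ∀ x : N, HasSum (fun k ↦ ⟪η k, (x : H →L[ℂ] H) (ξ k)⟫_ℂ) (φ x)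

end VonNeumannAlgebra

end

open scoped ComplexOrder MatrixOrder InnerProductSpace

noncomputable section

/-! ### The unitary group of a bounded positive resolvent -/

section ResolventFlow

variable {E : Type*} [NormedAddCommGroup E] [InnerProductSpace ℂ E] [CompleteSpace E]

/-! Write `Δ` for the modular operator, `Ω` for the GNS vector of `1` and `R = (1 + Δ)⁻¹`. The proof
turns invariance under `σ_t` into an algebraic relation. If `B = ρ(M_n)` is invariant, the
finite-dimensional space `BΩ` is invariant under the commuting unitaries `Δ^{it}`, hence spanned by
joint eigenvectors, hence invariant under `R` (`map_mem_of_resolventFlow_mem`). Being injective, `R`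
is bijective on `BΩ`; read in terms of `φ`, this gives for every `z ∈ B` some `x ∈ B` with `φ(zy) =
φ(yx)` for all `y ∈ N` (`exists_apply_mul_eq_of_isModularInvariant`).

Let `ω = Tr(h ·)`, and let `F i j` be matrix units in an eigenbasis of `h` with eigenvalues `l i`.
The relation `l j ω(F i j m) = l i ω(m F i j)` then passes to `φ` and to all of `N`
(`IsModularEmbedding.mul_apply_mul_eq`). In particular `ρ₁(F i₀ i₀)` and `ρ₂(F i₀ i₀)` are
projections of the centralizer with the same state. Since `φ` is a faithful trace on this factor, a
partial isometry `v` of the centralizer links them (`exists_star_mul_self_eq_of_apply_eq`). The sum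
`u = ∑ ρ₂(F i i₀) v ρ₁(F i₀ i)` is a unitary intertwiner, and it lies in the centralizer because the
scalars `l i / l i₀` and `l i₀ / l i` of its outer factors cancel.

Two analytic inputs remain. That `R (1 - R)` has dense range rests on `Ω` being cyclic for the
commutant (`isCommutantCyclic`). Comparison of projections comes from weak compactness of the unit
ball of the centralizer, through an extreme point and a nearest point. -/

/-- The function `z ↦ z^{1 - it} (1 - z)^{1 + it}`. -/
def flowFun (t : ℝ) (z : ℂ) : ℂ := z ^ (1 - Complex.I * t) * (1 - z) ^ (1 + Complex.I * t)

/-- The unitary `((1 - R) R⁻¹)^{it}` attached to `0 ≤ R ≤ 1`. -/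
def resolventFlow (R : E →L[ℂ] E) (t : ℝ) : E →L[ℂ] E :=
  (cfc (flowFun t) R).toLinearMap.extendOfNorm (R * (1 - R)).toLinearMap

lemma flowFun_zero_left (t : ℝ) : flowFun t 0 = 0 := by
  have : (1 - Complex.I * t : ℂ) ≠ 0 := fun h ↦ by simpa using congrArg Complex.re h
  simp [flowFun, Complex.zero_cpow this]

lemma flowFun_one_left (t : ℝ) : flowFun t 1 = 0 := by
  have : (1 + Complex.I * t : ℂ) ≠ 0 := fun h ↦ by simpa using congrArg Complex.re h
  simp [flowFun, Complex.zero_cpow this]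

lemma flowFun_ofReal (t : ℝ) {r : ℝ} (h₀ : 0 < r) (h₁ : r < 1) :
    flowFun t r =
      r * (1 - r) * Complex.exp (Complex.I * (t * (Real.log (1 - r) - Real.log r) : ℝ)) := by
  have hr : (r : ℂ) ≠ 0 := by exact_mod_cast h₀.ne'
  have hr' : (1 - r : ℂ) ≠ 0 := by exact_mod_cast (sub_pos.2 h₁).ne'
  have e : (1 - r : ℂ) = ((1 - r : ℝ) : ℂ) := by push_cast; ring
  rw [flowFun, sub_eq_add_neg, Complex.cpow_add _ _ hr, Complex.cpow_add _ _ hr',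
    Complex.cpow_one, Complex.cpow_one, Complex.cpow_def_of_ne_zero hr,
    Complex.cpow_def_of_ne_zero hr', e, ← Complex.ofReal_log h₀.le,
    ← Complex.ofReal_log (sub_pos.2 h₁).le]
  rw [show ∀ a b c d : ℂ, a * b * (c * d) = a * c * (b * d) by intros; ring, ← Complex.exp_add]
  congr 2
  push_cast
  ring

/-- The phase is `c = log ((1 - r) / r)` inside the interval. At the endpoints the factor `r (1 -
r)` vanishes and `c = 0` serves. -/
lemma flowFun_unit (t : ℝ) {r : ℝ} (hr : r ∈ Set.Icc (0 : ℝ) 1) :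
    ∃ c : ℝ, flowFun t r = r * (1 - r) * Complex.exp (Complex.I * (t * c : ℝ)) ∧
      ∀ s, flowFun s r = r * (1 - r) * Complex.exp (Complex.I * (s * c : ℝ)) := by
  rcases hr.1.eq_or_lt with rfl | h₀
  · exact ⟨0, by simp [flowFun_zero_left]⟩
  rcases hr.2.eq_or_lt with rfl | h₁
  · exact ⟨0, by simp [flowFun_one_left]⟩
  exact ⟨_, flowFun_ofReal t h₀ h₁, fun s ↦ flowFun_ofReal s h₀ h₁⟩

lemma star_flowFun (t : ℝ) {r : ℝ} (hr : r ∈ Set.Icc (0 : ℝ) 1) :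
    star (flowFun t r) = flowFun (-t) r := by
  obtain ⟨c, h, h'⟩ := flowFun_unit t hr
  rw [h, h' (-t), Complex.star_def, map_mul, ← Complex.exp_conj]
  simp

lemma star_flowFun_mul (t : ℝ) {r : ℝ} (hr : r ∈ Set.Icc (0 : ℝ) 1) :
    star (flowFun t r) * flowFun t r = (r * (1 - r)) * (r * (1 - r)) := by
  obtain ⟨c, h, h'⟩ := flowFun_unit t hr
  rw [star_flowFun t hr, h' (-t), h,
    show ∀ a b c d : ℂ, a * b * (c * d) = a * c * (b * d) by intros; ring, ← Complex.exp_add]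
  simp

/-- Both exponents have real part one, so the powers stay continuous where their base vanishes. -/
lemma continuousOn_flowFun (t : ℝ) :
    ContinuousOn (flowFun t) ((↑) '' Set.Icc (0 : ℝ) 1) := by
  rintro _ ⟨r, hr, rfl⟩
  apply ContinuousAt.continuousWithinAt
  unfold flowFun
  have h₁ : ContinuousAt (fun z : ℂ ↦ z ^ (1 - Complex.I * t)) r :=
    Complex.continuousAt_cpow_const_of_re_pos (Or.inl (by simpa using hr.1)) (by simp)
  have h₂ : ContinuousAt (fun z : ℂ ↦ z ^ (1 + Complex.I * t)) (1 - r) :=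
    Complex.continuousAt_cpow_const_of_re_pos (Or.inl (by simpa using hr.2)) (by simp)
  exact h₁.mul (ContinuousAt.comp (f := fun z : ℂ ↦ 1 - z) h₂ (by fun_prop))

variable {R : E →L[ℂ] E}

lemma spectrum_subset_Icc (h₀ : 0 ≤ R) (h₁ : R ≤ 1) :
    spectrum ℂ R ⊆ (↑) '' Set.Icc (0 : ℝ) 1 := by
  have hsa : IsSelfAdjoint R := .of_nonneg h₀
  have := hsa.spectrumRestricts.algebraMap_image
  rw [← this]
  rintro _ ⟨r, hr, rfl⟩
  refine ⟨r, ⟨spectrum_nonneg_of_nonneg h₀ hr, ?_⟩, rfl⟩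
  exact (le_algebraMap_iff_spectrum_le (a := R) (r := (1 : ℝ))).1 (by simpa using h₁) r hr

lemma continuousOn_flowFun_spectrum (h₀ : 0 ≤ R) (h₁ : R ≤ 1) (t : ℝ) :
    ContinuousOn (flowFun t) (spectrum ℂ R) :=
  (continuousOn_flowFun t).mono (spectrum_subset_Icc h₀ h₁)

lemma cfc_mul_one_sub (h₀ : 0 ≤ R) :
    cfc (fun z : ℂ ↦ z * (1 - z)) R = R * (1 - R) := by
  have hsa : IsStarNormal R := (IsSelfAdjoint.of_nonneg h₀).isStarNormal
  rw [cfc_mul _ _ R (by fun_prop) (by fun_prop), cfc_sub _ _ R (by fun_prop) (by fun_prop)]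
  simp [cfc_id', cfc_const_one]

lemma isSelfAdjoint_mul_one_sub (h₀ : 0 ≤ R) : IsSelfAdjoint (R * (1 - R)) := by
  have hsa : IsSelfAdjoint R := .of_nonneg h₀
  rw [IsSelfAdjoint, star_mul, star_sub, hsa.star_eq, star_one]
  noncomm_ring

lemma star_cfc_flowFun (h₀ : 0 ≤ R) (h₁ : R ≤ 1) (t : ℝ) :
    star (cfc (flowFun t) R) = cfc (flowFun (-t)) R := by
  rw [← cfc_star]
  refine cfc_congr fun z hz ↦ ?_
  obtain ⟨r, hr, rfl⟩ := spectrum_subset_Icc h₀ h₁ hz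
  exact star_flowFun t hr

/-- On the spectrum `flowFun t` has modulus `r (1 - r)`, so the two operators have the same absolute
value. This bound is what allows the extension defining `resolventFlow`. -/
lemma norm_cfc_flowFun_apply (h₀ : 0 ≤ R) (h₁ : R ≤ 1) (t : ℝ) (x : E) :
    ‖cfc (flowFun t) R x‖ = ‖(R * (1 - R)) x‖ := by
  have hc := continuousOn_flowFun_spectrum h₀ h₁
  have key : star (cfc (flowFun t) R) * cfc (flowFun t) R = star (R * (1 - R)) * (R * (1 - R)) := by
    rw [star_cfc_flowFun h₀ h₁, (isSelfAdjoint_mul_one_sub h₀).star_eq, ← cfc_mul_one_sub h₀,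
      ← cfc_mul _ _ R (hc _) (hc _), ← cfc_mul _ _ R (by fun_prop) (by fun_prop)]
    refine cfc_congr fun z hz ↦ ?_
    obtain ⟨r, hr, rfl⟩ := spectrum_subset_Icc h₀ h₁ hz
    simpa only [star_flowFun t hr] using star_flowFun_mul t hr
  have h (T : E →L[ℂ] E) : (‖T x‖ : ℂ) ^ 2 = ⟪x, (star T * T) x⟫_ℂ := by
    rw [ContinuousLinearMap.star_eq_adjoint, mul_apply_eq_comp,
      ContinuousLinearMap.adjoint_inner_right, inner_self_eq_norm_sq_to_K]
    rfl
  have := (h (cfc (flowFun t) R)).trans ((congrArg (fun T : E →L[ℂ] E ↦ ⟪x, T x⟫_ℂ) key).trans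
    (h (R * (1 - R))).symm)
  have h2 : ‖cfc (flowFun t) R x‖ ^ 2 = ‖(R * (1 - R)) x‖ ^ 2 := by exact_mod_cast this
  exact (sq_eq_sq₀ (norm_nonneg _) (norm_nonneg _)).1 h2

variable (h₀ : 0 ≤ R) (h₁ : R ≤ 1) (hd : DenseRange ⇑(R * (1 - R)))
include h₀ h₁ hd

lemma resolventFlow_apply (t : ℝ) (x : E) :
    resolventFlow R t ((R * (1 - R)) x) = cfc (flowFun t) R x :=
  LinearMap.extendOfNorm_eq (f := (cfc (flowFun t) R).toLinearMap)
    (e := (R * (1 - R)).toLinearMap) hd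
    ⟨1, fun x ↦ by rw [one_mul]; exact (norm_cfc_flowFun_apply h₀ h₁ t x).le⟩ x

lemma commute_resolventFlow_cfc (t : ℝ) (g : ℂ → ℂ) :
    Commute (resolventFlow R t) (cfc g R) := by
  refine ContinuousLinearMap.ext fun x ↦ ?_
  refine hd.induction_on x (isClosed_eq (by fun_prop) (by fun_prop)) fun y ↦ ?_
  have c₁ : Commute (cfc g R) (R * (1 - R)) := by
    rw [← cfc_mul_one_sub h₀]; exact cfc_commute_cfc _ _ _
  have c₂ : Commute (cfc g R) (cfc (flowFun t) R) := cfc_commute_cfc _ _ _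
  have e₁ := congrArg (fun T : E →L[ℂ] E ↦ T y) c₁.eq
  have e₂ := congrArg (fun T : E →L[ℂ] E ↦ T y) c₂.eq
  simp only [mul_apply_eq_comp] at e₁ e₂ ⊢
  have h := resolventFlow_apply h₀ h₁ hd t
  simp only [mul_apply_eq_comp] at h
  rw [e₁, h, h, e₂]

lemma commute_resolventFlow (s t : ℝ) :
    Commute (resolventFlow R s) (resolventFlow R t) := by
  have h := resolventFlow_apply h₀ h₁ hd
  have c (s t : ℝ) (x : E) : resolventFlow R s (cfc (flowFun t) R x) =
      cfc (flowFun t) R (resolventFlow R s x) :=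
    congrArg (fun T : E →L[ℂ] E ↦ T x) (commute_resolventFlow_cfc h₀ h₁ hd s (flowFun t)).eq
  have d (x : E) : cfc (flowFun t) R (resolventFlow R s x) =
      cfc (flowFun s) R (resolventFlow R t x) := by
    refine hd.induction_on x (isClosed_eq (by fun_prop) (by fun_prop)) fun y ↦ ?_
    rw [h, h]
    exact congrArg (fun T : E →L[ℂ] E ↦ T y) (cfc_commute_cfc (flowFun t) (flowFun s) R).eq
  refine ContinuousLinearMap.ext fun x ↦ ?_
  refine hd.induction_on x (isClosed_eq (by fun_prop) (by fun_prop)) fun y ↦ ?_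
  change resolventFlow R s (resolventFlow R t _) = resolventFlow R t (resolventFlow R s _)
  rw [h, h, c, c, d]

lemma inner_resolventFlow (t : ℝ) (x y : E) :
    ⟪resolventFlow R t x, y⟫_ℂ = ⟪x, resolventFlow R (-t) y⟫_ℂ := by
  refine hd.induction_on x (isClosed_eq (by fun_prop) (by fun_prop)) fun x ↦ ?_
  refine hd.induction_on y (isClosed_eq (by fun_prop) (by fun_prop)) fun y ↦ ?_
  rw [resolventFlow_apply h₀ h₁ hd, resolventFlow_apply h₀ h₁ hd,
    ← ContinuousLinearMap.adjoint_inner_right, ← ContinuousLinearMap.star_eq_adjoint,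
    star_cfc_flowFun h₀ h₁]
  have c : Commute (cfc (flowFun (-t)) R) (R * (1 - R)) := by
    rw [← cfc_mul_one_sub h₀]; exact cfc_commute_cfc _ _ _
  rw [← mul_apply_eq_comp, c.eq, mul_apply_eq_comp]
  nth_rw 1 [← (isSelfAdjoint_mul_one_sub h₀).star_eq]
  rw [ContinuousLinearMap.star_eq_adjoint, ContinuousLinearMap.adjoint_inner_right]

end ResolventFlow

/-! ### Joint eigenvectors and invariant subspaces of the flow. -/

section Invariance

variable {E : Type*} [NormedAddCommGroup E] [InnerProductSpace ℂ E] [CompleteSpace E]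

/-- A continuous function that vanishes on the common zeros, in the spectrum of `R`, of functions
`f` with `f(R) x = 0` also kills `x`. -/
lemma cfc_apply_eq_zero_of_forall_eq_zero {R : E →L[ℂ] E} (hR : IsStarNormal R) {x : E}
    {F : Set (ℂ → ℂ)} (hF : ∀ f ∈ F, ContinuousOn f (spectrum ℂ R) ∧ cfc f R x = 0)
    {g : ℂ → ℂ} (hg : ContinuousOn g (spectrum ℂ R))
    (h : ∀ z ∈ spectrum ℂ R, (∀ f ∈ F, f z = 0) → g z = 0) : cfc g R x = 0 := by
  -- The functions that kill `x` form a closed ideal of `C(spectrum ℂ R, ℂ)`, and a closed ideal is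
  -- determined by its common zeros.
  let I : Ideal C(spectrum ℂ R, ℂ) :=
    { carrier := {f | cfcHom hR f x = 0}
      add_mem' := fun {a b} ha hb ↦ by
        simp only [Set.mem_ofPred_eq] at ha hb ⊢
        simp [ha, hb]
      zero_mem' := by simp
      smul_mem' := fun c f hf ↦ by
        simp only [Set.mem_ofPred_eq] at hf ⊢
        rw [smul_eq_mul, map_mul, mul_apply_eq_comp, hf, map_zero] }
  have hI : IsClosed (I : Set C(spectrum ℂ R, ℂ)) := by
    have hc : Continuous fun f ↦ cfcHom hR f x :=
      (ContinuousLinearMap.apply ℂ E x).continuous.comp (cfcHom_continuous (R := ℂ) hR)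
    exact isClosed_eq hc continuous_const
  have mem (f : ℂ → ℂ) (hf : ContinuousOn f (spectrum ℂ R)) :
      (⟨_, hf.domRestrict⟩ : C(spectrum ℂ R, ℂ)) ∈ I ↔ cfc f R x = 0 := by
    rw [cfc_apply f R hR hf]
    rfl
  rw [← mem g hg, ← ContinuousMap.idealOfSet_ofIdeal_isClosed hI, ContinuousMap.mem_idealOfSet]
  intro z hz
  refine h z z.2 fun f hf ↦ ?_
  rw [Set.mem_compl_iff, ContinuousMap.notMem_setOfIdeal] at hz
  exact hz ((mem f (hF f hf).1).2 (hF f hf).2)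

lemma cfc_apply_of_eigenvector {R : E →L[ℂ] E} (hR : IsStarNormal R) {x : E} {r : ℂ}
    (hx : R x = r • x) {g : ℂ → ℂ} (hg : ContinuousOn g (spectrum ℂ R)) :
    cfc g R x = g r • x := by
  have h := cfc_apply_eq_zero_of_forall_eq_zero hR (x := x) (F := {fun z ↦ z - r})
    (g := fun z ↦ g z - g r) ?_ (by fun_prop) ?_
  · rw [cfc_sub _ _ R hg (by fun_prop), cfc_const _ R, sub_apply, sub_eq_zero] at h
    rw [h, Algebra.algebraMap_eq_smul_one]
    rfl
  · rintro _ rfl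
    refine ⟨by fun_prop, ?_⟩
    rw [cfc_sub _ _ R (by fun_prop) (by fun_prop), cfc_const _ R, cfc_id' ℂ R,
      sub_apply, hx, Algebra.algebraMap_eq_smul_one]
    exact sub_self _
  · intro z _ hz
    have hz' : z - r = 0 := hz (fun z ↦ z - r) rfl
    simp [sub_eq_zero.1 hz']

lemma injective_mul_one_sub {R : E →L[ℂ] E} (h₀ : 0 ≤ R) (hd : DenseRange ⇑(R * (1 - R))) :
    Function.Injective ⇑(R * (1 - R)) := by
  rw [injective_iff_map_eq_zero]
  intro x hx
  refine hd.eq_zero_of_inner_left (𝕜 := ℂ) fun y ↦ ?_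
  nth_rw 1 [← (isSelfAdjoint_mul_one_sub h₀).star_eq]
  rw [ContinuousLinearMap.star_eq_adjoint, ContinuousLinearMap.adjoint_inner_right, hx,
    inner_zero_left]

variable {R : E →L[ℂ] E} (h₀ : 0 ≤ R) (h₁ : R ≤ 1) (hd : DenseRange ⇑(R * (1 - R)))
include h₀ h₁ hd

/-- The eigenvalue `1/2` of `R` is the eigenvalue `1` of `Δ`, where the phase `log ((1 - r) / r)` is
zero. -/
lemma resolventFlow_apply_of_half (t : ℝ) {x : E} (hx : R x = (1 / 2 : ℂ) • x) :
    resolventFlow R t x = x := by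
  have hR : IsStarNormal R := (IsSelfAdjoint.of_nonneg h₀).isStarNormal
  have h := resolventFlow_apply h₀ h₁ hd t x
  rw [cfc_apply_of_eigenvector hR hx (continuousOn_flowFun_spectrum h₀ h₁ t)] at h
  have e : (R * (1 - R)) x = (1 / 4 : ℂ) • x := by
    rw [← cfc_mul_one_sub h₀, cfc_apply_of_eigenvector hR hx (by fun_prop)]
    norm_num
  have e' : flowFun t (1 / 2) = 1 / 4 := by
    have := flowFun_ofReal t (r := 1 / 2) (by norm_num) (by norm_num)
    norm_num at this ⊢
    exact this
  rw [e, e', map_smul] at h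
  exact smul_right_injective E (by norm_num : (1 / 4 : ℂ) ≠ 0) h

/-- A joint eigenvector of the unitaries is an eigenvector of `R`. -/
lemma exists_eigenvalue_of_resolventFlow {x : E} {c : ℝ → ℂ}
    (hx : ∀ t, resolventFlow R t x = c t • x) : ∃ r : ℂ, R x = r • x := by
  have hR : IsStarNormal R := (IsSelfAdjoint.of_nonneg h₀).isStarNormal
  have hc := continuousOn_flowFun_spectrum h₀ h₁
  let F : Set (ℂ → ℂ) := Set.range fun t z ↦ flowFun t z - c t * (z * (1 - z))
  have hF : ∀ f ∈ F, ContinuousOn f (spectrum ℂ R) ∧ cfc f R x = 0 := by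
    rintro _ ⟨t, rfl⟩
    refine ⟨(hc t).sub (by fun_prop), ?_⟩
    rw [cfc_sub _ _ R (hc t) (by fun_prop), cfc_const_mul _ _ R (by fun_prop), cfc_mul_one_sub h₀,
      sub_apply, smul_apply,
      ← resolventFlow_apply h₀ h₁ hd, ← cfc_mul_one_sub h₀]
    have := congrArg (fun T : E →L[ℂ] E ↦ T x)
      (commute_resolventFlow_cfc h₀ h₁ hd t fun z ↦ z * (1 - z)).eq
    simp only [mul_apply_eq_comp] at this
    rw [this, hx, map_smul, sub_self]
  -- The functions of `F` have at most one common zero in the spectrum apart from `0` and `1`; the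
  -- factor `z * (1 - z)` takes care of these two.
  obtain ⟨r, hr⟩ : ∃ r : ℂ, ∀ z ∈ spectrum ℂ R, (∀ f ∈ F, f z = 0) →
      (z - r) * (z * (1 - z)) = 0 := by
    by_contra! hcon
    obtain ⟨_, ha, hFa, ha'⟩ := hcon 0
    -- Taking the first zero as the candidate `r` yields a second one, distinct from it.
    obtain ⟨_, hb, hFb, hb'⟩ := hcon ‹_›
    obtain ⟨a, haI, rfl⟩ := spectrum_subset_Icc h₀ h₁ ha
    obtain ⟨b, hbI, rfl⟩ := spectrum_subset_Icc h₀ h₁ hb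
    have key (s : ℝ) (hs : s ∈ Set.Icc (0 : ℝ) 1) (hs' : (s : ℂ) * (1 - s) ≠ 0)
        (hFs : ∀ f ∈ F, f s = 0) : 0 < s ∧ s < 1 ∧
        ∀ t : ℝ, Complex.exp (Complex.I * (t * (Real.log (1 - s) - Real.log s) : ℝ)) = c t := by
      have s₀ : 0 < s := hs.1.lt_of_ne (by rintro rfl; simp at hs')
      have s₁ : s < 1 := hs.2.lt_of_ne (by rintro rfl; simp at hs')
      refine ⟨s₀, s₁, fun t ↦ ?_⟩
      have := hFs _ ⟨t, rfl⟩
      simp only [flowFun_ofReal t s₀ s₁] at this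
      rw [mul_comm (c t), ← mul_sub] at this
      exact sub_eq_zero.1 ((mul_eq_zero.1 this).resolve_left hs')
    obtain ⟨a₀, a₁, hca⟩ := key a haI (right_ne_zero_of_mul ha') hFa
    obtain ⟨b₀, b₁, hcb⟩ := key b hbI (right_ne_zero_of_mul hb') hFb
    have hab : Real.log (1 - a) - Real.log a ≠ Real.log (1 - b) - Real.log b := by
      have hne : b ≠ a := by
        rintro rfl
        simp at hb'
      rcases hne.lt_or_gt with h | h
      · have h1 := Real.log_lt_log b₀ h
        have h2 := Real.log_lt_log (sub_pos.2 a₁) (sub_lt_sub_left h 1)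
        linarith
      · have h1 := Real.log_lt_log a₀ h
        have h2 := Real.log_lt_log (sub_pos.2 b₁) (sub_lt_sub_left h 1)
        linarith
    set α := Real.log (1 - a) - Real.log a
    set β := Real.log (1 - b) - Real.log b
    -- At this time the two phases differ by `exp (iπ) = -1`, although both equal `c t`.
    have h := (hca (Real.pi / (α - β))).trans (hcb (Real.pi / (α - β))).symm
    have hsub := sub_ne_zero.2 hab
    have e : Complex.I * (Real.pi / (α - β) * α : ℝ) =
        Complex.I * (Real.pi / (α - β) * β : ℝ) + Real.pi * Complex.I := by
      have : Real.pi / (α - β) * α = Real.pi / (α - β) * β + Real.pi := by field_simp; ring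
      rw [this]; push_cast; ring
    rw [e, Complex.exp_add, Complex.exp_pi_mul_I] at h
    have hne := Complex.exp_ne_zero (Complex.I * (Real.pi / (α - β) * β : ℝ))
    exact hne (by linear_combination (-1 / 2 : ℂ) * h)
  refine ⟨r, ?_⟩
  have h := cfc_apply_eq_zero_of_forall_eq_zero hR hF (by fun_prop) hr
  rw [cfc_mul _ _ R (by fun_prop) (by fun_prop), cfc_sub _ _ R (by fun_prop) (by fun_prop),
    cfc_id' ℂ R, cfc_const _ R, cfc_mul_one_sub h₀] at h
  have hcomm : (R - algebraMap ℂ (E →L[ℂ] E) r) * (R * (1 - R)) =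
      (R * (1 - R)) * (R - algebraMap ℂ (E →L[ℂ] E) r) := by
    have hc : Commute R (R * (1 - R)) :=
      (Commute.refl R).mul_right ((Commute.one_right R).sub_right (Commute.refl R))
    exact (hc.sub_left (Algebra.commute_algebraMap_left r _)).eq
  rw [hcomm, mul_apply_eq_comp] at h
  -- Injectivity of `R (1 - R)` removes the auxiliary factor.
  have := (injective_iff_map_eq_zero _).1 (injective_mul_one_sub h₀ hd) _ h
  rw [sub_apply, sub_eq_zero, Algebra.algebraMap_eq_smul_one] at this
  exact this

/-- A finite-dimensional subspace that is invariant under the unitaries is invariant under `R`. -/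
lemma map_mem_of_resolventFlow_mem (K : Submodule ℂ E) [FiniteDimensional ℂ K]
    (hK : ∀ t, ∀ x ∈ K, resolventFlow R t x ∈ K) {x : E} (hx : x ∈ K) : R x ∈ K := by
  have hcomm (s t : ℝ) (x : E) : resolventFlow R s (resolventFlow R t x) =
      resolventFlow R t (resolventFlow R s x) :=
    congrArg (fun T : E →L[ℂ] E ↦ T x) (commute_resolventFlow h₀ h₁ hd s t).eq
  let U (t : ℝ) : K →ₗ[ℂ] K := (resolventFlow R t).toLinearMap.restrict (hK t)
  have hU (s t : ℝ) : Commute (U s) (U t) :=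
    LinearMap.ext fun x ↦ Subtype.ext (hcomm s t x)
  -- The spectral theorem for commuting families is applied to symmetric operators, so `U t` is
  -- replaced by the combinations `c U t + c̄ U (-t)`. The values `c = 1` and `c = i` recover it: `U
  -- t = (T (t, 1) - i T (t, i)) / 2`.
  let T (i : ℝ × ℂ) : K →ₗ[ℂ] K := i.2 • U i.1 + star i.2 • U (-i.1)
  have hT (i) : (T i).IsSymmetric := by
    have h (t : ℝ) (x y : K) : ⟪U t x, y⟫_ℂ = ⟪x, U (-t) y⟫_ℂ :=
      inner_resolventFlow h₀ h₁ hd t x y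
    intro x y
    simp only [T, LinearMap.add_apply, LinearMap.smul_apply, inner_add_left, inner_add_right,
      inner_smul_left, inner_smul_right, h, neg_neg, Complex.star_def, Complex.conj_conj]
    ring
  have hTc : Pairwise (Function.onFun Commute T) := fun i j _ ↦ by
    have h (s t : ℝ) (a b : ℂ) : Commute (a • U s) (b • U t) :=
      ((hU s t).smul_left a).smul_right b
    exact ((h _ _ _ _).add_right (h _ _ _ _)).add_left ((h _ _ _ _).add_right (h _ _ _ _))
  have htop := LinearMap.IsSymmetric.iSup_iInf_eq_top_of_commute hT hTc
  suffices h : (⊤ : Submodule ℂ K) ≤ (K.comap R.toLinearMap).comap K.subtype from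
    h (Submodule.mem_top : (⟨x, hx⟩ : K) ∈ ⊤)
  rw [← htop, iSup_le_iff]
  intro χ y hy
  rw [Submodule.mem_iInf] at hy
  have hy' (i) := Module.End.mem_eigenspace_iff.1 (hy i)
  obtain ⟨r, hr⟩ := exists_eigenvalue_of_resolventFlow h₀ h₁ hd (x := (y : E))
    (c := fun t ↦ (χ (t, 1) - Complex.I * χ (t, Complex.I)) / 2) fun t ↦ by
      have a := congrArg (Subtype.val : K → E) (hy' (t, 1))
      have b := congrArg (Subtype.val : K → E) (hy' (t, Complex.I))
      simp only [T, LinearMap.add_apply, LinearMap.smul_apply, Submodule.coe_add,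
        Submodule.coe_smul, one_smul, Complex.star_def, Complex.conj_I, map_one] at a b
      have hUt (t) : ((U t y : K) : E) = resolventFlow R t y := rfl
      rw [hUt, hUt] at a b
      have b' := congrArg (fun v ↦ (-Complex.I) • v) b
      simp only [smul_add, smul_smul, neg_mul, mul_neg, Complex.I_mul_I, neg_neg, one_smul] at b'
      linear_combination (norm := module) (1 / 2 : ℂ) • a + (1 / 2 : ℂ) • b'
  change R y ∈ K
  rw [hr]
  exact K.smul_mem r y.2

end Invariance

/-! ### The GNS space and the resolvent of the modular operator -/

namespace PositiveLinearMap

variable {A : Type*} [CStarAlgebra A] [PartialOrder A] [StarOrderedRing A] (φ : A →ₚ[ℂ] ℂ)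

/-- The vector of the GNS space represented by an element of the algebra. -/
def toGNS : A →ₗ[ℂ] φ.GNS :=
  (UniformSpace.Completion.toComplL (𝕜 := ℂ) (E := φ.PreGNS)).toLinearMap ∘ₗ φ.toPreGNS.toLinearMap

/-- The vector of the domain of `S` represented by an element of the algebra. -/
def toDomS : A →ₗ[ℂ] φ.DomS :=
  (UniformSpace.Completion.toComplL (𝕜 := ℂ) (E := φ.PreDomS)).toLinearMap ∘ₗ
    φ.toPreDomS.toLinearMap

lemma inner_toGNS (a b : A) : ⟪φ.toGNS a, φ.toGNS b⟫_ℂ = φ (star a * b) :=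
  UniformSpace.Completion.inner_coe _ _

lemma inner_toDomS (a b : A) :
    ⟪φ.toDomS a, φ.toDomS b⟫_ℂ = φ (star a * b) + φ (b * star a) :=
  UniformSpace.Completion.inner_coe _ _

lemma denseRange_toGNS : DenseRange φ.toGNS :=
  UniformSpace.Completion.denseRange_coe (α := φ.PreGNS)

lemma denseRange_toDomS : DenseRange φ.toDomS :=
  UniformSpace.Completion.denseRange_coe (α := φ.PreDomS)

lemma gnsStarAlgHom_toGNS (a b : A) : φ.gnsStarAlgHom a (φ.toGNS b) = φ.toGNS (a * b) :=
  φ.gnsNonUnitalStarAlgHom_apply_coe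

lemma domSIncl_toDomS (a : A) : φ.domSIncl (φ.toDomS a) = φ.toGNS a :=
  ContinuousLinearMap.completion_apply_coe _ _

lemma denseRange_domSIncl : DenseRange φ.domSIncl := by
  refine φ.denseRange_toGNS.mono ?_
  rintro _ ⟨a, rfl⟩
  exact ⟨_, φ.domSIncl_toDomS a⟩

lemma norm_toGNS_sq (a : A) : ((‖φ.toGNS a‖ ^ 2 : ℝ) : ℂ) = φ (star a * a) := by
  rw [← inner_toGNS, inner_self_eq_norm_sq_to_K]
  norm_cast

lemma norm_toDomS_sq (a : A) : ‖φ.toDomS a‖ ^ 2 = ‖φ.toGNS a‖ ^ 2 + ‖φ.toGNS (star a)‖ ^ 2 := by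
  have : ((‖φ.toDomS a‖ ^ 2 : ℝ) : ℂ) =
      ((‖φ.toGNS a‖ ^ 2 + ‖φ.toGNS (star a)‖ ^ 2 : ℝ) : ℂ) := by
    rw [Complex.ofReal_add, norm_toGNS_sq, norm_toGNS_sq, star_star, ← inner_toDomS,
      inner_self_eq_norm_sq_to_K]
    norm_cast
  exact_mod_cast this

lemma gnsStarAlgHom_toGNS_one (a : A) : φ.gnsStarAlgHom a (φ.toGNS 1) = φ.toGNS a := by
  rw [gnsStarAlgHom_toGNS, mul_one]

/-- The closed operator `S`, as a map on its domain. -/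
def domSConj : φ.DomS → φ.GNS :=
  UniformSpace.Completion.map fun a : φ.PreDomS ↦ φ.toPreGNS (star (φ.ofPreDomS a))

lemma uniformContinuous_preDomSConj :
    UniformContinuous fun a : φ.PreDomS ↦ φ.toPreGNS (star (φ.ofPreDomS a)) := by
  refine LipschitzWith.uniformContinuous (K := 1) (LipschitzWith.of_dist_le_mul fun a b ↦ ?_)
  have h : ‖φ.toGNS (star (φ.ofPreDomS (a - b)))‖ ≤ ‖φ.toDomS (φ.ofPreDomS (a - b))‖ := by
    refine le_of_sq_le_sq ?_ (norm_nonneg _)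
    rw [norm_toDomS_sq]
    exact le_add_of_nonneg_left (sq_nonneg _)
  rw [NNReal.coe_one, one_mul, dist_eq_norm, dist_eq_norm, ← map_sub, ← star_sub, ← map_sub]
  calc _ = _ := (UniformSpace.Completion.norm_coe _).symm
    _ ≤ _ := h
    _ = _ := UniformSpace.Completion.norm_coe _

lemma continuous_domSConj : Continuous φ.domSConj := UniformSpace.Completion.continuous_map

lemma domSConj_toDomS (a : A) : φ.domSConj (φ.toDomS a) = φ.toGNS (star a) :=
  UniformSpace.Completion.map_coe φ.uniformContinuous_preDomSConj _

lemma norm_sq_domS (ζ : φ.DomS) : ‖ζ‖ ^ 2 = ‖φ.domSIncl ζ‖ ^ 2 + ‖φ.domSConj ζ‖ ^ 2 := by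
  have := φ.continuous_domSConj
  refine φ.denseRange_toDomS.induction_on ζ (isClosed_eq (by fun_prop) (by fun_prop)) fun a ↦ ?_
  rw [norm_toDomS_sq, domSIncl_toDomS, domSConj_toDomS]

lemma norm_domSIncl_le (ζ : φ.DomS) : ‖φ.domSIncl ζ‖ ≤ ‖ζ‖ := by
  refine le_of_sq_le_sq ?_ (norm_nonneg _)
  rw [norm_sq_domS]
  exact le_add_of_nonneg_right (sq_nonneg _)

lemma inner_modularResolvent (x y : φ.GNS) :
    ⟪x, φ.modularResolvent y⟫_ℂ = ⟪φ.domSIncl.adjoint x, φ.domSIncl.adjoint y⟫_ℂ :=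
  (ContinuousLinearMap.adjoint_inner_left φ.domSIncl _ _).symm

lemma norm_adjoint_domSIncl_le (x : φ.GNS) : ‖φ.domSIncl.adjoint x‖ ≤ ‖x‖ := by
  have h : ‖φ.domSIncl.adjoint‖ ≤ 1 := by
    rw [LinearIsometryEquiv.norm_map]
    exact ContinuousLinearMap.opNorm_le_bound _ zero_le_one fun ζ ↦ by
      rw [one_mul]; exact φ.norm_domSIncl_le ζ
  exact (ContinuousLinearMap.le_of_opNorm_le _ h x).trans_eq (one_mul _)

lemma modularResolvent_nonneg : 0 ≤ φ.modularResolvent := by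
  rw [ContinuousLinearMap.nonneg_iff_isPositive]
  exact ContinuousLinearMap.isPositive_self_comp_adjoint _

lemma modularResolvent_le_one : φ.modularResolvent ≤ 1 := by
  rw [ContinuousLinearMap.le_def, ContinuousLinearMap.isPositive_iff_complex]
  intro x
  have h : ⟪x, (1 - φ.modularResolvent) x⟫_ℂ =
      ((‖x‖ ^ 2 - ‖φ.domSIncl.adjoint x‖ ^ 2 : ℝ) : ℂ) := by
    rw [sub_apply, inner_sub_right, inner_modularResolvent, inner_self_eq_norm_sq_to_K,
      one_apply_eq_self, inner_self_eq_norm_sq_to_K]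
    norm_cast
  have h' : ⟪(1 - φ.modularResolvent) x, x⟫_ℂ =
      ((‖x‖ ^ 2 - ‖φ.domSIncl.adjoint x‖ ^ 2 : ℝ) : ℂ) := by
    rw [← inner_conj_symm, h, Complex.conj_ofReal]
  rw [h']
  refine ⟨by rw [RCLike.re_to_complex, Complex.ofReal_re], ?_⟩
  have := φ.norm_adjoint_domSIncl_le x
  simp only [RCLike.re_to_complex, Complex.ofReal_re, sub_nonneg]
  gcongr

/-- This is `ΔΩ = Ω`: against `a`, the graph inner product with `1` is twice the GNS inner product.
-/
lemma modularResolvent_toGNS_one : φ.modularResolvent (φ.toGNS 1) = (1 / 2 : ℂ) • φ.toGNS 1 := by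
  have h : φ.domSIncl.adjoint (φ.toGNS 1) = (1 / 2 : ℂ) • φ.toDomS 1 := by
    rw [← sub_eq_zero]
    refine φ.denseRange_toDomS.eq_zero_of_inner_right (𝕜 := ℂ) fun a ↦ ?_
    rw [inner_sub_right, ContinuousLinearMap.adjoint_inner_right, domSIncl_toDomS, inner_toGNS,
      inner_smul_right, inner_toDomS, one_mul, mul_one]
    ring
  change φ.domSIncl (φ.domSIncl.adjoint _) = _
  rw [h, map_smul, domSIncl_toDomS]

lemma modularResolvent_injective : Function.Injective φ.modularResolvent := by
  rw [injective_iff_map_eq_zero]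
  intro x hx
  have h : φ.domSIncl.adjoint x = 0 := by
    rw [← inner_self_eq_zero (𝕜 := ℂ), ← inner_modularResolvent, hx, inner_zero_right]
  refine φ.denseRange_domSIncl.eq_zero_of_inner_left (𝕜 := ℂ) fun y ↦ ?_
  rw [← ContinuousLinearMap.adjoint_inner_left, h, inner_zero_left]

/-- The vector `1` is cyclic for the commutant of the GNS representation. -/
def IsCommutantCyclic : Prop :=
  ∀ θ : φ.GNS, (∀ T : φ.GNS →L[ℂ] φ.GNS, (∀ a, Commute T (φ.gnsStarAlgHom a)) →
    ⟪T (φ.toGNS 1), θ⟫_ℂ = 0) → θ = 0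

/-! ### Non-degeneracy of the modular operator, and the twisted trace property. -/

variable {φ}

lemma commute_star_gnsStarAlgHom {T : φ.GNS →L[ℂ] φ.GNS} (hT : ∀ a, Commute T (φ.gnsStarAlgHom a))
    (a : A) : Commute (star T) (φ.gnsStarAlgHom a) := by
  rw [← star_star a, map_star]
  exact (hT (star a)).star_star

/-- For `T` in the commutant, `TΩ` lies in the domain of `S*` and `S* TΩ = T* Ω`. -/
lemma inner_domSConj {T : φ.GNS →L[ℂ] φ.GNS} (hT : ∀ a, Commute T (φ.gnsStarAlgHom a))
    (ζ : φ.DomS) : ⟪φ.domSConj ζ, T (φ.toGNS 1)⟫_ℂ = ⟪star T (φ.toGNS 1), φ.domSIncl ζ⟫_ℂ := by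
  have := φ.continuous_domSConj
  refine φ.denseRange_toDomS.induction_on ζ (isClosed_eq (by fun_prop) (by fun_prop)) fun a ↦ ?_
  have h := congrArg (fun F : φ.GNS →L[ℂ] φ.GNS ↦ F (φ.toGNS 1)) (hT a).eq
  simp only [mul_apply_eq_comp, gnsStarAlgHom_toGNS_one] at h
  rw [domSConj_toDomS, domSIncl_toDomS, ContinuousLinearMap.star_eq_adjoint,
    ContinuousLinearMap.adjoint_inner_left, h, ← gnsStarAlgHom_toGNS_one, map_star,
    ContinuousLinearMap.star_eq_adjoint, ContinuousLinearMap.adjoint_inner_left]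

/-- This is closability of `a ↦ a*`: its adjoint is defined on the vectors `TΩ`, whose span is
dense. -/
lemma domSIncl_injective (h : φ.IsCommutantCyclic) : Function.Injective φ.domSIncl := by
  rw [injective_iff_map_eq_zero]
  intro ζ hζ
  have h' : φ.domSConj ζ = 0 := h _ fun T hT ↦ by
    rw [← inner_conj_symm, inner_domSConj hT, hζ, inner_zero_right, map_zero]
  simpa [hζ, h'] using φ.norm_sq_domS ζ

/-- If `Rθ = θ`, then `ι*θ` has graph norm at most the norm of its image `θ`, which leaves nothing
for `S ι*θ`. So `θ` is in the kernel of `S`, hence orthogonal to all `TΩ`. -/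
lemma one_sub_modularResolvent_injective (h : φ.IsCommutantCyclic) :
    Function.Injective ⇑(1 - φ.modularResolvent) := by
  rw [injective_iff_map_eq_zero]
  intro θ hθ
  have hθ' : φ.modularResolvent θ = θ := (sub_eq_zero.1 hθ).symm
  have h₁ : ‖φ.domSIncl.adjoint θ‖ ≤ ‖φ.domSIncl (φ.domSIncl.adjoint θ)‖ :=
    (φ.norm_adjoint_domSIncl_le θ).trans_eq (congrArg norm hθ'.symm)
  have h₂ : φ.domSConj (φ.domSIncl.adjoint θ) = 0 := by
    have h₃ := φ.norm_sq_domS (φ.domSIncl.adjoint θ)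
    have h₄ := pow_le_pow_left₀ (norm_nonneg _) h₁ 2
    rw [← norm_eq_zero, ← sq_eq_zero_iff]
    nlinarith [sq_nonneg ‖φ.domSConj (φ.domSIncl.adjoint θ)‖]
  rw [← hθ']
  refine h _ fun T hT ↦ ?_
  have h₅ := inner_domSConj (T := star T) (commute_star_gnsStarAlgHom hT) (φ.domSIncl.adjoint θ)
  rw [h₂, inner_zero_left, star_star] at h₅
  exact h₅.symm

lemma denseRange_modularResolvent_mul (h : φ.IsCommutantCyclic) :
    DenseRange ⇑(φ.modularResolvent * (1 - φ.modularResolvent)) := by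
  have hinj : Function.Injective ⇑(φ.modularResolvent * (1 - φ.modularResolvent)) :=
    φ.modularResolvent_injective.comp (one_sub_modularResolvent_injective h)
  have hsa := isSelfAdjoint_mul_one_sub φ.modularResolvent_nonneg
  set W := φ.modularResolvent * (1 - φ.modularResolvent)
  have htop : (LinearMap.range W.toLinearMap).topologicalClosure = ⊤ := by
    rw [Submodule.topologicalClosure_eq_top_iff, Submodule.eq_bot_iff]
    intro x hx
    refine hinj ?_
    rw [map_zero, ← inner_self_eq_zero (𝕜 := ℂ)]
    nth_rw 2 [← hsa.star_eq]
    rw [ContinuousLinearMap.star_eq_adjoint, ContinuousLinearMap.adjoint_inner_right]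
    exact (Submodule.mem_orthogonal _ _).1 hx _ ⟨W x, rfl⟩
  exact Submodule.dense_iff_topologicalClosure_eq_top.2 htop

/-- A finite-dimensional modular-invariant subalgebra has a twist of the trace property of `φ`. -/
lemma exists_apply_mul_eq_of_isModularInvariant (h : φ.IsCommutantCyclic)
    (B : Submodule ℂ A) [FiniteDimensional ℂ B]
    (hB : φ.IsModularInvariant B) {z : A} (hz : z ∈ B) : ∃ x ∈ B, ∀ y, φ (z * y) = φ (y * x) := by
  have h₀ := φ.modularResolvent_nonneg
  have h₁ := φ.modularResolvent_le_one
  have hd := denseRange_modularResolvent_mul h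
  have hU (t : ℝ) : φ.modularUnitary t = resolventFlow φ.modularResolvent t := rfl
  have hmem : ∀ x ∈ B.map φ.toGNS, φ.modularResolvent x ∈ B.map φ.toGNS := fun x hx ↦ by
    refine map_mem_of_resolventFlow_mem h₀ h₁ hd (B.map φ.toGNS) (fun t x hx ↦ ?_) hx
    obtain ⟨b, hb, rfl⟩ := hx
    have hb' : φ.modularAut t (φ.gnsStarAlgHom b) ∈ φ.gnsStarAlgHom '' B := by
      rw [← hB t]
      exact ⟨_, ⟨b, hb, rfl⟩, rfl⟩
    obtain ⟨c, hc, hbc⟩ := hb'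
    refine ⟨c, hc, ?_⟩
    have := congrArg (fun T : φ.GNS →L[ℂ] φ.GNS ↦ T (φ.toGNS 1)) hbc
    simp only [modularAut, mul_apply_eq_comp, gnsStarAlgHom_toGNS_one, hU] at this
    -- Since `Δ^{-it}` fixes `Ω`, the vector `σ_t(b) Ω` is `Δ^{it} b Ω`.
    rw [this, resolventFlow_apply_of_half h₀ h₁ hd (-t) φ.modularResolvent_toGNS_one,
      gnsStarAlgHom_toGNS_one]
  obtain ⟨⟨_, x, hx, rfl⟩, hxz⟩ := (LinearMap.injective_iff_surjective
    (f := φ.modularResolvent.toLinearMap.restrict hmem)).1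
      (fun a b hab ↦ Subtype.ext (φ.modularResolvent_injective (congrArg Subtype.val hab)))
      ⟨φ.toGNS z, z, hz, rfl⟩
  have hxz' : φ.domSIncl (φ.domSIncl.adjoint (φ.toGNS x)) = φ.toGNS z := congrArg Subtype.val hxz
  have key : φ.domSIncl.adjoint (φ.toGNS x) = φ.toDomS z :=
    domSIncl_injective h (hxz'.trans (φ.domSIncl_toDomS z).symm)
  -- Pairing `ι* x = z` with `y*` in the graph inner product reads `φ(yx) = φ(yz) + φ(zy)`.
  refine ⟨x - z, B.sub_mem hx hz, fun y ↦ ?_⟩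
  have := congrArg (fun ζ ↦ ⟪φ.toDomS (star y), ζ⟫_ℂ) key
  simp only [ContinuousLinearMap.adjoint_inner_right, domSIncl_toDomS, inner_toGNS, inner_toDomS,
    star_star] at this
  rw [mul_sub, map_sub, this]
  ring

end PositiveLinearMap

/-! ### The commutant of the GNS representation of a normal faithful functional -/

lemma map_mem_of_mem_topologicalClosure {E F : Type*} [NormedAddCommGroup E] [NormedSpace ℂ E]
    [NormedAddCommGroup F] [NormedSpace ℂ F] (f : E →L[ℂ] F) {S : Submodule ℂ E} {P : Submodule ℂ F}
    (hP : IsClosed (P : Set F)) (h : ∀ s ∈ S, f s ∈ P) {v : E}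
    (hv : v ∈ S.topologicalClosure) : f v ∈ P :=
  Submodule.topologicalClosure_minimal (t := P.comap f.toLinearMap) _ h
    (hP.preimage f.continuous) hv

lemma map_mem_of_mem_topologicalClosure_span {E F : Type*} [NormedAddCommGroup E] [NormedSpace ℂ E]
    [NormedAddCommGroup F] [NormedSpace ℂ F] (f : E →L[ℂ] F) {S : Set E} {P : Submodule ℂ F}
    (hP : IsClosed (P : Set F)) (h : ∀ s ∈ S, f s ∈ P) {v : E}
    (hv : v ∈ (Submodule.span ℂ S).topologicalClosure) : f v ∈ P :=
  map_mem_of_mem_topologicalClosure f hP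
    (Submodule.span_le (p := P.comap f.toLinearMap).2 h) hv

lemma denseRange_codRestrict_topologicalClosure {M F : Type*} [AddCommGroup M] [Module ℂ M]
    [NormedAddCommGroup F] [NormedSpace ℂ F] (e : M →ₗ[ℂ] F) :
    DenseRange (e.codRestrict (LinearMap.range e).topologicalClosure fun x ↦
      Submodule.le_topologicalClosure _ ⟨x, rfl⟩) := by
  intro u
  rw [Topology.IsInducing.subtypeVal.closure_eq_preimage_closure_image, ← Set.range_comp]
  exact u.2

/-- The adjoint of a densely defined bounded operator `e x ↦ f x`. -/
lemma exists_inner_eq_of_norm_le {M F G : Type*} [AddCommGroup M] [Module ℂ M]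
    [NormedAddCommGroup F] [InnerProductSpace ℂ F] [CompleteSpace F]
    [NormedAddCommGroup G] [InnerProductSpace ℂ G] [CompleteSpace G]
    (e : M →ₗ[ℂ] F) (f : M →ₗ[ℂ] G) (h : ∀ x, ‖f x‖ ≤ ‖e x‖) :
    ∃ W : G →L[ℂ] F, (∀ g, W g ∈ (LinearMap.range e).topologicalClosure) ∧
      ∀ x g, ⟪e x, W g⟫_ℂ = ⟪f x, g⟫_ℂ := by
  let K := (LinearMap.range e).topologicalClosure
  have : CompleteSpace K := (Submodule.isClosed_topologicalClosure _).completeSpace_coe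
  let e' : M →ₗ[ℂ] K := e.codRestrict K fun x ↦ Submodule.le_topologicalClosure _ ⟨x, rfl⟩
  let V : K →L[ℂ] G := f.extendOfNorm e'
  have hV (x) : V (e' x) = f x := LinearMap.extendOfNorm_eq
    (denseRange_codRestrict_topologicalClosure e) ⟨1, fun x ↦ by rw [one_mul]; exact h x⟩ x
  refine ⟨K.subtypeL ∘L V.adjoint, fun g ↦ (V.adjoint g).2, fun x g ↦ ?_⟩
  rw [← hV, ← ContinuousLinearMap.adjoint_inner_right]
  rfl

namespace VonNeumannAlgebra

variable {H : Type*} [NormedAddCommGroup H] [InnerProductSpace ℂ H] [CompleteSpace H]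
  {N : VonNeumannAlgebra H} {φ : N →ₚ[ℂ] ℂ}

/-- The bounded operators from the GNS space to `H` that intertwine the two actions of `N`. -/
def IsGNSIntertwiner (φ : N →ₚ[ℂ] ℂ) (A : φ.GNS →L[ℂ] H) : Prop :=
  ∀ (x : N) (v : φ.GNS), A (φ.gnsStarAlgHom x v) = (x : H →L[ℂ] H) (A v)

/-- The operator `x ⊗ 1` on a countable sum of copies of `H`. -/
def amplify (ι : Type*) (x : H →L[ℂ] H) :
    lp (fun _ : ι ↦ H) 2 →L[ℂ] lp (fun _ : ι ↦ H) 2 :=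
  lp.mapCLM 2 (fun _ ↦ x) (norm_nonneg x) fun _ ↦ le_rfl

omit [CompleteSpace H] in
lemma amplify_apply {ι : Type*} (x : H →L[ℂ] H) (u : lp (fun _ : ι ↦ H) 2) (i : ι) :
    amplify ι x u i = x (u i) := rfl

lemma inner_amplify {ι : Type*} (x : H →L[ℂ] H) (u v : lp (fun _ : ι ↦ H) 2) :
    ⟪u, amplify ι x v⟫_ℂ = ⟪amplify ι (star x) u, v⟫_ℂ := by
  simp only [lp.inner_eq_tsum, amplify_apply]
  refine tsum_congr fun i ↦ ?_
  rw [ContinuousLinearMap.star_eq_adjoint, ContinuousLinearMap.adjoint_inner_left]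

/-- The orbit map `x ↦ (x ⊗ 1) ζ`. -/
def amplifyOrbit {ι : Type*} (N : VonNeumannAlgebra H) (ζ : lp (fun _ : ι ↦ H) 2) :
    N →ₗ[ℂ] lp (fun _ : ι ↦ H) 2 where
  toFun x := amplify ι x ζ
  map_add' _ _ := by ext; rfl
  map_smul' _ _ := by ext; rfl

omit [InnerProductSpace ℂ H] [CompleteSpace H] in
lemma memℓp_sumElim {ξ η : ℕ → H} (hξ : Summable fun k ↦ ‖ξ k‖ ^ 2)
    (hη : Summable fun k ↦ ‖η k‖ ^ 2) :
    Memℓp (E := fun _ : ℕ ⊕ ℕ ↦ H) (Sum.elim ξ η) 2 := by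
  refine memℓp_gen ?_
  simp only [ENNReal.toReal_ofNat, Real.rpow_ofNat]
  exact Summable.sum (f := fun i : ℕ ⊕ ℕ ↦ ‖Sum.elim ξ η i‖ ^ 2) hξ hη

/-- Expand `φ(x* x) = ∑ ⟪x η k, x ξ k⟫` and apply Cauchy–Schwarz termwise. Joining `ξ` and `η` into
one vector indexed by `ℕ ⊕ ℕ` bounds `φ` on positive elements by a vector functional of the
amplification. -/
lemma norm_toGNS_le_of_hasSum {ξ η : ℕ → H} (hξ : Summable fun k ↦ ‖ξ k‖ ^ 2)
    (hη : Summable fun k ↦ ‖η k‖ ^ 2)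
    (hsum : ∀ x : N, HasSum (fun k ↦ ⟪η k, (x : H →L[ℂ] H) (ξ k)⟫_ℂ) (φ x)) (x : N) :
    ‖φ.toGNS x‖ ≤ ‖amplifyOrbit N ⟨_, memℓp_sumElim hξ hη⟩ x‖ := by
  set u := amplifyOrbit N ⟨_, memℓp_sumElim hξ hη⟩ x with hu
  have hl (k) : u (Sum.inl k) = (x : H →L[ℂ] H) (ξ k) := rfl
  have hr (k) : u (Sum.inr k) = (x : H →L[ℂ] H) (η k) := rfl
  have hn : HasSum (fun i ↦ ‖u i‖ ^ 2) (‖u‖ ^ 2) := by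
    have := lp.hasSum_norm (p := 2) (by simp) u
    simpa using this
  have hs₁ : Summable fun k ↦ ‖u (Sum.inl k)‖ ^ 2 :=
    hn.summable.comp_injective Sum.inl_injective
  have hs₂ : Summable fun k ↦ ‖u (Sum.inr k)‖ ^ 2 :=
    hn.summable.comp_injective Sum.inr_injective
  have htot : HasSum (fun k ↦ ‖u (Sum.inl k)‖ ^ 2 + ‖u (Sum.inr k)‖ ^ 2) (‖u‖ ^ 2) := by
    rw [← (HasSum.sum (f := fun i ↦ ‖u i‖ ^ 2) hs₁.hasSum hs₂.hasSum).unique hn]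
    exact hs₁.hasSum.add hs₂.hasSum
  have hφ : HasSum (fun k ↦ ⟪u (Sum.inr k), u (Sum.inl k)⟫_ℂ) (φ (star x * x)) := by
    convert hsum (star x * x) using 2 with k
    rw [hl, hr, ← ContinuousLinearMap.adjoint_inner_right, ← ContinuousLinearMap.star_eq_adjoint]
    rfl
  rw [← φ.norm_toGNS_sq] at hφ
  have hle : ‖((‖φ.toGNS x‖ ^ 2 : ℝ) : ℂ)‖ ≤ ‖u‖ ^ 2 := by
    rw [← hφ.tsum_eq, ← htot.tsum_eq]
    refine tsum_of_norm_bounded htot.summable.hasSum fun k ↦ ?_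
    have h₁ := norm_inner_le_norm (𝕜 := ℂ) (u (Sum.inr k)) (u (Sum.inl k))
    nlinarith [sq_nonneg (‖u (Sum.inl k)‖ - ‖u (Sum.inr k)‖), sq_nonneg ‖u (Sum.inl k)‖,
      sq_nonneg ‖u (Sum.inr k)‖]
  rw [Complex.norm_real, Real.norm_of_nonneg (sq_nonneg _)] at hle
  exact le_of_sq_le_sq hle (norm_nonneg _)

/-- The intertwiners from the GNS space of a normal functional to `H` separate points. -/
lemma eq_zero_of_forall_isGNSIntertwiner (hφ : IsNormal φ) {θ : φ.GNS}
    (hθ : ∀ A, IsGNSIntertwiner φ A → A θ = 0) : θ = 0 := by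
  obtain ⟨ξ, η, hξ, hη, hsum⟩ := hφ
  set ζ : lp (fun _ : ℕ ⊕ ℕ ↦ H) 2 := ⟨_, memℓp_sumElim hξ hη⟩
  set e := amplifyOrbit N ζ
  -- `W` is the adjoint of the contraction `(x ⊗ 1) ζ ↦ x Ω`. It is injective because that
  -- contraction has dense range, and its coordinates will be the required intertwiners.
  obtain ⟨W, hWK, hW⟩ := exists_inner_eq_of_norm_le e φ.toGNS (norm_toGNS_le_of_hasSum hξ hη hsum)
  have hint (x : N) (v : φ.GNS) :
      W (φ.gnsStarAlgHom x v) = amplify _ (x : H →L[ℂ] H) (W v) := by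
    have hmap : amplify _ (x : H →L[ℂ] H) (W v) ∈ (LinearMap.range e).topologicalClosure := by
      refine map_mem_of_mem_topologicalClosure (amplify _ (x : H →L[ℂ] H))
        (Submodule.isClosed_topologicalClosure _) ?_ (hWK v)
      rintro _ ⟨y, rfl⟩
      exact Submodule.le_topologicalClosure _ ⟨x * y, rfl⟩
    -- Testing on orbit vectors only sees the component in the orbit closure; both terms lie in this
    -- closure, so that suffices.
    have horth : W (φ.gnsStarAlgHom x v) - amplify _ (x : H →L[ℂ] H) (W v) ∈
        (LinearMap.range e).topologicalClosureᗮ := by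
      rw [Submodule.orthogonal_closure, Submodule.mem_orthogonal]
      rintro _ ⟨y, rfl⟩
      have h₁ : amplify _ (star (x : H →L[ℂ] H)) (e y) = e (star x * y) := rfl
      rw [inner_sub_right, hW, inner_amplify, h₁, hW, ← φ.gnsStarAlgHom_toGNS, map_star,
        ContinuousLinearMap.star_eq_adjoint, ContinuousLinearMap.adjoint_inner_left, sub_self]
    exact sub_eq_zero.1 ((Submodule.mem_bot ℂ).1 ((Submodule.inf_orthogonal_eq_bot _).le
      ⟨Submodule.sub_mem _ (hWK _) hmap, horth⟩))
  have hA (i) : IsGNSIntertwiner φ (lp.evalCLM ℂ (fun _ ↦ H) 2 i ∘L W) :=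
    fun x v ↦ congrArg (fun w : lp (fun _ ↦ H) 2 ↦ w i) (hint x v)
  have hzero : W θ = 0 := lp.ext (funext fun i ↦ hθ _ (hA i))
  refine φ.denseRange_toGNS.eq_zero_of_inner_right (𝕜 := ℂ) fun x ↦ ?_
  rw [← hW, hzero, inner_zero_right]

/-- For a faithful normal state of a von Neumann algebra, the vector `1` of the GNS space is cyclic
for the commutant. -/
lemma isCommutantCyclic (hφ : IsFaithfulState φ) (hφn : IsNormal φ) : φ.IsCommutantCyclic := by
  intro θ hθ
  let Ω := φ.toGNS 1
  let C : Set (φ.GNS →L[ℂ] φ.GNS) := {T | ∀ a, Commute T (φ.gnsStarAlgHom a)}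
  let L := (Submodule.span ℂ ((fun T ↦ T Ω) '' C)).topologicalClosure
  have hTL (T) (hT : T ∈ C) (v) (hv : v ∈ L) : T v ∈ L := by
    refine map_mem_of_mem_topologicalClosure_span T
      (Submodule.isClosed_topologicalClosure _) ?_ hv
    rintro _ ⟨T', hT', rfl⟩
    exact Submodule.le_topologicalClosure _
      (Submodule.subset_span ⟨T * T', fun a ↦ (hT a).mul_left (hT' a), rfl⟩)
  -- The aim is to realise the projection onto `Lᗮ` by an element of `N`. Intertwiners carry `Lᗮ`
  -- into `X` and `L` into `Xᗮ`, so the projection `y` onto `X`, which lies in `N`, acts on the GNS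
  -- space as the projection onto `Lᗮ`.
  let X := (Submodule.span ℂ
    {h : H | ∃ A, IsGNSIntertwiner φ A ∧ ∃ v ∈ Lᗮ, A v = h}).topologicalClosure
  have : CompleteSpace L := (Submodule.isClosed_topologicalClosure _).completeSpace_coe
  have : CompleteSpace X := (Submodule.isClosed_topologicalClosure _).completeSpace_coe
  have hcX (c) (hc : c ∈ N.commutant) (h) (hh : h ∈ X) : c h ∈ X := by
    refine map_mem_of_mem_topologicalClosure_span c
      (Submodule.isClosed_topologicalClosure _) ?_ hh
    rintro _ ⟨A, hA, v, hv, rfl⟩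
    refine Submodule.le_topologicalClosure _
      (Submodule.subset_span ⟨c ∘L A, fun x w ↦ ?_, v, hv, rfl⟩)
    rw [ContinuousLinearMap.comp_apply, hA]
    exact congrArg (fun T : H →L[ℂ] H ↦ T (A w))
      (mem_commutant_iff.1 hc (x : H →L[ℂ] H) x.2).symm
  have hN : X.starProjection ∈ N := by
    rw [IsStarProjection.mem_iff isStarProjection_starProjection]
    intro c hc
    rw [Module.End.mem_invtSubmodule]
    intro h hh
    rw [Submodule.range_starProjection] at hh
    change c h ∈ X.starProjection.range
    rw [Submodule.range_starProjection]
    exact hcX c hc h hh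
  have hAX (A) (hA : IsGNSIntertwiner φ A) (v) (hv : v ∈ L) : A v ∈ Xᗮ := by
    rw [Submodule.orthogonal_closure, Submodule.mem_orthogonal]
    intro h hh
    induction hh using Submodule.span_induction with
    | mem h hh =>
      obtain ⟨B, hB, w, hw, rfl⟩ := hh
      rw [← ContinuousLinearMap.adjoint_inner_right]
      -- For intertwiners `A` and `B`, the product `B* A` is in the commutant, so it preserves `L`.
      have hBA : B.adjoint ∘L A ∈ C := fun a ↦ by
        refine ContinuousLinearMap.ext fun z ↦ ext_inner_left ℂ fun z' ↦ ?_
        simp only [mul_apply_eq_comp, ContinuousLinearMap.comp_apply]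
        rw [ContinuousLinearMap.adjoint_inner_right, hA, ← star_star a, map_star,
          ContinuousLinearMap.star_eq_adjoint (φ.gnsStarAlgHom (star a)),
          ContinuousLinearMap.adjoint_inner_right, ContinuousLinearMap.adjoint_inner_right, hB]
        change _ = ⟪star (a : H →L[ℂ] H) (B z'), A z⟫_ℂ
        rw [star_star, ContinuousLinearMap.star_eq_adjoint, ContinuousLinearMap.adjoint_inner_left]
      exact Submodule.inner_left_of_mem_orthogonal (hTL _ hBA v hv) hw
    | zero => exact inner_zero_left _
    | add a b _ _ ha hb => rw [inner_add_left, ha, hb, add_zero]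
    | smul c a _ ha => rw [inner_smul_left, ha, mul_zero]
  have hAL (A) (hA : IsGNSIntertwiner φ A) (v) (hv : v ∈ Lᗮ) : A v ∈ X :=
    Submodule.le_topologicalClosure _ (Submodule.subset_span ⟨A, hA, v, hv, rfl⟩)
  let y : N := ⟨_, hN⟩
  have hyL (v) (hv : v ∈ L) : φ.gnsStarAlgHom y v = 0 :=
    eq_zero_of_forall_isGNSIntertwiner hφn fun A hA ↦ by
      rw [hA]
      exact X.starProjection_apply_eq_zero_iff.2 (hAX A hA v hv)
  have hyL' (v) (hv : v ∈ Lᗮ) : φ.gnsStarAlgHom y v = v := by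
    rw [← sub_eq_zero]
    refine eq_zero_of_forall_isGNSIntertwiner hφn fun A hA ↦ ?_
    rw [map_sub, hA, sub_eq_zero]
    exact X.starProjection_eq_self_iff.2 (hAL A hA v hv)
  have hΩ : Ω ∈ L := Submodule.le_topologicalClosure _
    (Submodule.subset_span ⟨1, fun a ↦ Commute.one_left _, rfl⟩)
  -- `Ω` lies in `L` and is separating for `N`, so `y` vanishes and with it `Lᗮ`.
  have hy : y = 0 := by
    refine hφ.faithful y ?_
    rw [← φ.norm_toGNS_sq, ← φ.gnsStarAlgHom_toGNS_one, hyL _ hΩ]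
    simp
  have hθL : θ ∈ Lᗮ := by
    rw [Submodule.orthogonal_closure, Submodule.mem_orthogonal]
    intro h hh
    induction hh using Submodule.span_induction with
    | mem h hh =>
      obtain ⟨T, hT, rfl⟩ := hh
      exact hθ T hT
    | zero => exact inner_zero_left _
    | add a b _ _ ha hb => rw [inner_add_left, ha, hb, add_zero]
    | smul c a _ ha => rw [inner_smul_left, ha, mul_zero]
  rw [← hyL' θ hθL, hy, map_zero, zero_apply]

end VonNeumannAlgebra

/-! ### The weak operator topology of a von Neumann algebra -/

namespace VonNeumannAlgebra

variable {H : Type*} [NormedAddCommGroup H] [InnerProductSpace ℂ H] [CompleteSpace H]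

/-- The matrix coefficients of an element of `N`. -/
def matrixCoeff (N : VonNeumannAlgebra H) : N →ₗ[ℝ] (H → H → ℂ) where
  toFun x ξ η := ⟪ξ, (x : H →L[ℂ] H) η⟫_ℂ
  map_add' x y := by
    ext ξ η
    exact inner_add_right _ _ _
  map_smul' r x := by
    ext ξ η
    change ⟪ξ, (r : ℂ) • (x : H →L[ℂ] H) η⟫_ℂ = r • ⟪ξ, (x : H →L[ℂ] H) η⟫_ℂ
    rw [inner_smul_right, Complex.real_smul]

variable {N : VonNeumannAlgebra H}

lemma matrixCoeff_injective : Function.Injective N.matrixCoeff := fun _ _ h ↦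
  Subtype.ext (ContinuousLinearMap.ext fun η ↦ ext_inner_left ℂ fun ξ ↦ congrFun (congrFun h ξ) η)

/-- The weak operator topology. -/
@[reducible] def weakTopology (N : VonNeumannAlgebra H) : TopologicalSpace N :=
  .induced N.matrixCoeff inferInstance

/-- The operator of a bounded family of matrix coefficients. -/
lemma exists_operator_of_matrixCoeff (b : H → H → ℂ)
    (add_left : ∀ ξ ξ' η, b (ξ + ξ') η = b ξ η + b ξ' η)
    (smul_left : ∀ (c : ℂ) ξ η, b (c • ξ) η = star c * b ξ η)
    (add_right : ∀ ξ η η', b ξ (η + η') = b ξ η + b ξ η')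
    (smul_right : ∀ (c : ℂ) ξ η, b ξ (c • η) = c * b ξ η)
    (bound : ∀ ξ η, ‖b ξ η‖ ≤ ‖ξ‖ * ‖η‖) :
    ∃ T : H →L[ℂ] H, ‖T‖ ≤ 1 ∧ ∀ ξ η, ⟪ξ, T η⟫_ℂ = b ξ η := by
  let B : H →L⋆[ℂ] H →L[ℂ] ℂ := LinearMap.mkContinuous₂
    (LinearMap.mk₂'ₛₗ (starRingEnd ℂ) (RingHom.id ℂ) b add_left smul_left add_right smul_right) 1
    fun ξ η ↦ by rw [one_mul]; exact bound ξ η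
  let T := (InnerProductSpace.continuousLinearMapOfBilin B).adjoint
  have hT (ξ η) : ⟪ξ, T η⟫_ℂ = b ξ η := by
    rw [ContinuousLinearMap.adjoint_inner_right]
    exact InnerProductSpace.continuousLinearMapOfBilin_apply B ξ η
  refine ⟨T, ContinuousLinearMap.opNorm_le_bound _ zero_le_one fun η ↦ ?_, hT⟩
  have h := bound (T η) η
  rw [← hT, inner_self_eq_norm_sq_to_K] at h
  rcases (norm_nonneg (T η)).eq_or_lt with h0 | h0
  · rw [← h0]; positivity
  · rw [one_mul]
    refine le_of_mul_le_mul_left (le_of_eq_of_le ?_ h) h0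
    simp [sq]

/-- Along an ultrafilter the matrix coefficients converge to a bounded sesquilinear form. Its
operator still commutes with the commutant, so it belongs to `N`. -/
lemma isCompact_weakTopology_unitBall :
    @IsCompact N N.weakTopology {x | ‖x‖ ≤ 1} := by
  let _ := N.weakTopology
  rw [isCompact_iff_ultrafilter_le_nhds]
  intro U hU
  rw [Filter.le_principal_iff] at hU
  have hlim (ξ η : H) : ∃ c, Filter.Tendsto (fun x ↦ N.matrixCoeff x ξ η) U (nhds c) ∧
      ‖c‖ ≤ ‖ξ‖ * ‖η‖ := by
    have hmem : Metric.closedBall (0 : ℂ) (‖ξ‖ * ‖η‖) ∈ U.map (fun x ↦ N.matrixCoeff x ξ η) := by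
      refine Ultrafilter.mem_map.2 (Filter.mem_of_superset hU fun x hx ↦ ?_)
      rw [Set.mem_preimage, mem_closedBall_zero_iff]
      refine (norm_inner_le_norm _ _).trans ?_
      gcongr
      exact ((x : H →L[ℂ] H).le_of_opNorm_le hx η).trans_eq (one_mul _)
    obtain ⟨c, hc, hc'⟩ := isCompact_iff_ultrafilter_le_nhds.1
      (isCompact_closedBall (0 : ℂ) (‖ξ‖ * ‖η‖)) _ (Filter.le_principal_iff.2 hmem)
    exact ⟨c, hc', mem_closedBall_zero_iff.1 hc⟩
  choose b hb hbound using hlim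
  have uniq {f : N → ℂ} {c c' : ℂ} (h : Filter.Tendsto f U (nhds c))
    (h' : Filter.Tendsto f U (nhds c')) : c = c' := tendsto_nhds_unique h h'
  obtain ⟨T, hT, hTb⟩ := exists_operator_of_matrixCoeff b
    (fun ξ ξ' η ↦ uniq (hb _ _)
      (((hb ξ η).add (hb ξ' η)).congr fun x ↦ (inner_add_left _ _ _).symm))
    (fun c ξ η ↦ uniq (hb _ _) (((hb ξ η).const_mul _).congr fun x ↦ (inner_smul_left _ _ _).symm))
    (fun ξ η η' ↦ uniq (hb _ _) (((hb ξ η).add (hb ξ η')).congr fun x ↦ by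
      simp only [matrixCoeff, LinearMap.coe_mk, AddHom.coe_mk, map_add, inner_add_right]))
    (fun c ξ η ↦ uniq (hb _ _) (((hb ξ η).const_mul _).congr fun x ↦ by
      simp only [matrixCoeff, LinearMap.coe_mk, AddHom.coe_mk, map_smul, inner_smul_right]))
    hbound
  have hTN : T ∈ N := by
    rw [← N.commutant_commutant, mem_commutant_iff]
    intro c hc
    refine ContinuousLinearMap.ext fun η ↦ ext_inner_left ℂ fun ξ ↦ ?_
    rw [mul_apply_eq_comp, mul_apply_eq_comp, hTb, ← ContinuousLinearMap.adjoint_inner_left, hTb]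
    refine uniq ((hb _ _).congr fun x ↦ ?_) (hb ξ (c η))
    change ⟪c.adjoint ξ, (x : H →L[ℂ] H) η⟫_ℂ = ⟪ξ, (x : H →L[ℂ] H) (c η)⟫_ℂ
    rw [ContinuousLinearMap.adjoint_inner_left]
    exact congrArg (fun F : H →L[ℂ] H ↦ ⟪ξ, F η⟫_ℂ) (mem_commutant_iff.1 hc _ x.2).symm
  refine ⟨⟨T, hTN⟩, hT, ?_⟩
  rw [nhds_induced, ← Filter.tendsto_iff_comap, tendsto_pi_nhds]
  intro ξ
  rw [tendsto_pi_nhds]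
  intro η
  change Filter.Tendsto _ _ (nhds ⟪ξ, T η⟫_ℂ)
  rw [hTb]
  exact hb ξ η

lemma t2Space_weakTopology : @T2Space N N.weakTopology :=
  let _ := N.weakTopology
  .of_injective_continuous matrixCoeff_injective continuous_induced_dom

lemma exists_extremePoints_weakTopology {S : Set N} (hS : @IsCompact N N.weakTopology S)
    (hne : S.Nonempty) : (S.extremePoints ℝ).Nonempty := by
  let _ := N.weakTopology
  have := t2Space_weakTopology (N := N)
  have : IsTopologicalAddGroup N := topologicalAddGroup_induced N.matrixCoeff
  have : ContinuousSMul ℝ N := continuousSMul_induced N.matrixCoeff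
  have : LocallyConvexSpace ℝ N := LocallyConvexSpace.induced N.matrixCoeff
  exact hS.extremePoints_nonempty hne

lemma continuous_mul_mul_weakTopology (a b : N) :
    @Continuous N N N.weakTopology N.weakTopology fun x ↦ a * x * b := by
  let _ := N.weakTopology
  rw [continuous_induced_rng, continuous_pi_iff]
  intro ξ
  rw [continuous_pi_iff]
  intro η
  have h : Continuous fun x : N ↦ N.matrixCoeff x (star (a : H →L[ℂ] H) ξ) ((b : H →L[ℂ] H) η) :=
    (continuous_apply _).comp ((continuous_apply _).comp continuous_induced_dom)
  refine h.congr fun x ↦ ?_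
  exact ContinuousLinearMap.adjoint_inner_left _ _ _

/-- Each term of the series is weakly continuous, and on the unit ball a summable bound makes the
convergence uniform. -/
lemma continuousOn_weakTopology {φ : N →ₚ[ℂ] ℂ} (hφ : IsNormal φ) (a b : N) :
    @ContinuousOn N ℂ N.weakTopology _ (fun x ↦ φ (a * x * b)) {x | ‖x‖ ≤ 1} := by
  let _ := N.weakTopology
  obtain ⟨ξ, η, hξ, hη, hsum⟩ := hφ
  have heq : (fun x ↦ φ (a * x * b)) = fun x ↦ ∑' k,
      N.matrixCoeff x (star (a : H →L[ℂ] H) (η k)) ((b : H →L[ℂ] H) (ξ k)) := by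
    ext x
    rw [← (hsum _).tsum_eq]
    exact tsum_congr fun k ↦ (ContinuousLinearMap.adjoint_inner_left (a : H →L[ℂ] H)
      ((x : H →L[ℂ] H) ((b : H →L[ℂ] H) (ξ k))) (η k)).symm
  rw [heq]
  refine continuousOn_tsum (u := fun k ↦ (‖star (a : H →L[ℂ] H)‖ * ‖(b : H →L[ℂ] H)‖) *
    (‖ξ k‖ ^ 2 + ‖η k‖ ^ 2)) (fun k ↦ Continuous.continuousOn ?_) ((hξ.add hη).mul_left _)
    fun k x hx ↦ ?_
  · exact (continuous_apply _).comp ((continuous_apply _).comp continuous_induced_dom)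
  · have h₁ := (star (a : H →L[ℂ] H)).le_opNorm (η k)
    have h₂ := (b : H →L[ℂ] H).le_opNorm (ξ k)
    have h₃ := ((x : H →L[ℂ] H).le_of_opNorm_le hx ((b : H →L[ℂ] H) (ξ k))).trans_eq (one_mul _)
    calc _ ≤ ‖star (a : H →L[ℂ] H) (η k)‖ * ‖(x : H →L[ℂ] H) ((b : H →L[ℂ] H) (ξ k))‖ :=
          norm_inner_le_norm _ _
      _ ≤ (‖star (a : H →L[ℂ] H)‖ * ‖η k‖) * (‖(b : H →L[ℂ] H)‖ * ‖ξ k‖) := by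
          gcongr; exact h₃.trans h₂
      _ = (‖star (a : H →L[ℂ] H)‖ * ‖(b : H →L[ℂ] H)‖) * (‖ξ k‖ * ‖η k‖) := by ring
      _ ≤ _ := by
          gcongr
          nlinarith [sq_nonneg (‖ξ k‖ - ‖η k‖), sq_nonneg ‖ξ k‖, sq_nonneg ‖η k‖]

lemma isCompact_weakTopology_centralizer {φ : N →ₚ[ℂ] ℂ} (hφ : IsNormal φ) :
    @IsCompact N N.weakTopology {x | x ∈ φ.stateCentralizer ∧ ‖x‖ ≤ 1} := by
  let _ := N.weakTopology
  have := t2Space_weakTopology (N := N)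
  have hball : IsCompact {x : N | ‖x‖ ≤ 1} := isCompact_weakTopology_unitBall
  -- The ball is repeated inside the intersection because continuity of `φ` is available only there.
  have heq : {x : N | x ∈ φ.stateCentralizer ∧ ‖x‖ ≤ 1} = {x : N | ‖x‖ ≤ 1} ∩
      ⋂ y, ({x : N | ‖x‖ ≤ 1} ∩ (fun x ↦ φ (1 * x * y) - φ (y * x * 1)) ⁻¹' {0}) := by
    ext x
    simp only [Set.mem_inter_iff, Set.mem_iInter, Set.mem_preimage, Set.mem_singleton_iff, one_mul,
      mul_one, sub_eq_zero, Set.mem_ofPred_eq]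
    exact ⟨fun h ↦ ⟨h.2, fun y ↦ ⟨h.2, h.1 y⟩⟩, fun h ↦ ⟨fun y ↦ (h.2 y).2, h.1⟩⟩
  rw [heq]
  refine hball.inter_right (isClosed_iInter fun y ↦ ?_)
  exact ((continuousOn_weakTopology hφ 1 y).sub
    (continuousOn_weakTopology hφ y 1)).preimage_isClosed_of_isClosed hball.isClosed
      isClosed_singleton

lemma isClosed_weakTopology_mul_mul_eq (a b c d : N) :
    @IsClosed N N.weakTopology {x | a * x * b = c * x * d} := by
  let _ := N.weakTopology
  have := t2Space_weakTopology (N := N)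
  exact isClosed_eq (continuous_mul_mul_weakTopology a b) (continuous_mul_mul_weakTopology c d)

end VonNeumannAlgebra

/-! ### Comparison of projections in a factorial centralizer -/

namespace PositiveLinearMap

variable {A : Type*} [CStarAlgebra A] [PartialOrder A] [StarOrderedRing A] {φ : A →ₚ[ℂ] ℂ}

lemma mem_stateCentralizer {x : A} : x ∈ φ.stateCentralizer ↔ ∀ y, φ (x * y) = φ (y * x) := Iff.rfl

lemma isClosed_stateCentralizer : IsClosed (φ.stateCentralizer : Set A) := by
  have heq : (φ.stateCentralizer : Set A) = ⋂ y, {x | φ (x * y) = φ (y * x)} := by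
    ext x
    simp only [Set.mem_iInter, SetLike.mem_coe]
    rfl
  have hc : Continuous φ := map_continuous φ
  rw [heq]
  exact isClosed_iInter fun y ↦ isClosed_eq (by fun_prop) (by fun_prop)

/-- An element that commutes with the unitaries of the centralizer commutes with the centralizer. -/
lemma commute_of_forall_unitary {z : A}
    (hz : ∀ u ∈ φ.stateCentralizer, u ∈ unitary A → Commute z u) {x : A}
    (hx : x ∈ φ.stateCentralizer) : Commute z x := by
  have : IsClosed (φ.stateCentralizer : Set A) := isClosed_stateCentralizer
  obtain ⟨u, c, hu, -⟩ := CStarAlgebra.exists_sum_four_unitary (⟨x, hx⟩ : φ.stateCentralizer)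
  have hx' : x = ∑ i, c i • ((u i : φ.stateCentralizer) : A) := by
    have := congrArg φ.stateCentralizer.subtype hu
    rw [map_sum] at this
    exact this
  rw [hx']
  refine Commute.sum_right _ _ _ fun i _ ↦ (hz _ (u i).1.2 ?_).smul_right (c i)
  have h := Unitary.mem_iff.1 (u i).2
  exact Unitary.mem_iff.2 ⟨congrArg Subtype.val h.1, congrArg Subtype.val h.2⟩

lemma toGNS_eq_zero_iff (hφ : IsFaithfulState φ) {x : A} : φ.toGNS x = 0 ↔ x = 0 := by
  refine ⟨fun h ↦ hφ.faithful x ?_, fun h ↦ by rw [h, map_zero]⟩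
  rw [← φ.norm_toGNS_sq, h]
  simp

lemma norm_toGNS_conj {u : A} (hu : u ∈ φ.stateCentralizer) (hu' : u ∈ unitary A) (x : A) :
    ‖φ.toGNS (u * x * star u)‖ = ‖φ.toGNS x‖ := by
  have h : ((‖φ.toGNS (u * x * star u)‖ ^ 2 : ℝ) : ℂ) = ((‖φ.toGNS x‖ ^ 2 : ℝ) : ℂ) := by
    have h₁ := (Unitary.mem_iff.1 hu').1
    have h₂ : star (u * x * star u) * (u * x * star u) = u * (star x * x * star u) := by
      simp only [star_mul, star_star]
      calc _ = u * star x * (star u * u) * x * star u := by noncomm_ring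
        _ = _ := by rw [h₁]; noncomm_ring
    rw [norm_toGNS_sq, norm_toGNS_sq, h₂, mem_stateCentralizer.1 hu, mul_assoc, h₁, mul_one]
  have h' : ‖φ.toGNS (u * x * star u)‖ ^ 2 = ‖φ.toGNS x‖ ^ 2 := by exact_mod_cast h
  exact (sq_eq_sq₀ (norm_nonneg _) (norm_nonneg _)).1 h'

end PositiveLinearMap

lemma norm_le_one_of_star_mul_self_le_one {A : Type*} [CStarAlgebra A] [PartialOrder A]
    [StarOrderedRing A] {x : A} (h : star x * x ≤ 1) : ‖x‖ ≤ 1 := by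
  have h' := (CStarAlgebra.norm_le_one_iff_of_nonneg (star x * x) (star_mul_self_nonneg x)).2 h
  rw [CStarRing.norm_star_mul_self] at h'
  nlinarith [norm_nonneg x]

lemma star_mul_self_le_one {A : Type*} [CStarAlgebra A] [PartialOrder A]
    [StarOrderedRing A] {x : A} (h : ‖x‖ ≤ 1) : star x * x ≤ 1 := by
  refine (CStarAlgebra.norm_le_one_iff_of_nonneg (star x * x) (star_mul_self_nonneg x)).1 ?_
  rw [CStarRing.norm_star_mul_self]
  nlinarith [norm_nonneg x]

/-- Two vectors of minimal norm coincide when their midpoint is not shorter. -/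
lemma eq_of_norm_le_norm_midpoint {E : Type*} [NormedAddCommGroup E] [InnerProductSpace ℂ E]
    {a b : E} (hab : ‖b‖ ≤ ‖a‖) (h : ‖a‖ ≤ ‖(1 / 2 : ℝ) • (a + b)‖) : a = b := by
  have h₁ := parallelogram_law_with_norm ℂ a b
  rw [norm_smul] at h
  norm_num at h
  have h₂ : ‖a - b‖ * ‖a - b‖ ≤ 0 := by
    nlinarith [norm_nonneg a, norm_nonneg b, norm_nonneg (a + b)]
  have h₃ : ‖a - b‖ = 0 := by nlinarith [norm_nonneg (a - b)]
  exact sub_eq_zero.1 (norm_eq_zero.1 h₃)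

lemma eq_zero_of_add_sub_mem_of_mem_extremePoints {E : Type*} [AddCommGroup E] [Module ℝ E]
    {S : Set E} {v d : E} (hv : v ∈ S.extremePoints ℝ) (h₁ : v + d ∈ S) (h₂ : v - d ∈ S) :
    d = 0 := by
  have := (mem_extremePoints.1 hv).2 _ h₁ _ h₂
    ⟨1 / 2, 1 / 2, by norm_num, by norm_num, by norm_num, by module⟩
  simpa using this.1

namespace VonNeumannAlgebra

variable {H : Type*} [NormedAddCommGroup H] [InnerProductSpace ℂ H] [CompleteSpace H]
  {N : VonNeumannAlgebra H} {φ : N →ₚ[ℂ] ℂ}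

/-- By `‖b‖² ≥ 2 Re ⟪a, b⟫ - ‖a‖²`, with equality at `b = a`, the function has a weakly continuous
minorant touching it at any given point of the ball. -/
lemma lowerSemicontinuousOn_weakTopology (hφ : IsNormal φ) :
    @LowerSemicontinuousOn N ℝ N.weakTopology _ (fun x ↦ ‖φ.toGNS (1 - x)‖ ^ 2)
      {x | ‖x‖ ≤ 1} := by
  let _ := N.weakTopology
  intro x hx c hc
  have hcont : ContinuousOn (fun y ↦ 2 * (φ (star (1 - x)) - φ (star (1 - x) * y * 1)).re -
      ‖φ.toGNS (1 - x)‖ ^ 2) {x : N | ‖x‖ ≤ 1} :=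
    (continuousOn_const.mul (Complex.continuous_re.comp_continuousOn
      (continuousOn_const.sub (continuousOn_weakTopology hφ _ _)))).sub continuousOn_const
  have hval (y : N) : (φ (star (1 - x)) - φ (star (1 - x) * y * 1)).re =
      (⟪φ.toGNS (1 - x), φ.toGNS (1 - y)⟫_ℂ).re := by
    rw [φ.inner_toGNS, mul_sub, mul_one, mul_one, map_sub]
  have hx' : c < 2 * (φ (star (1 - x)) - φ (star (1 - x) * x * 1)).re -
      ‖φ.toGNS (1 - x)‖ ^ 2 := by
    have h₁ := inner_self_eq_norm_sq (𝕜 := ℂ) (φ.toGNS (1 - x))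
    rw [RCLike.re_to_complex] at h₁
    have hc' : c < ‖φ.toGNS (1 - x)‖ ^ 2 := hc
    rw [hval, h₁]
    linarith
  filter_upwards [(hcont x hx).eventually (lt_mem_nhds hx')] with y hy
  refine hy.trans_le ?_
  rw [hval]
  have h₁ := norm_sub_sq (𝕜 := ℂ) (φ.toGNS (1 - x)) (φ.toGNS (1 - y))
  simp only [RCLike.re_to_complex] at h₁
  nlinarith [sq_nonneg ‖φ.toGNS (1 - x) - φ.toGNS (1 - y)‖]

/-- In a factorial centralizer, `q B p = 0` for projections `p`, `q` implies `p = 0` or `q = 0`. -/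
lemma eq_zero_or_eq_zero_of_forall_mul_mul_eq_zero (hφ : IsFaithfulState φ) (hφn : IsNormal φ)
    [hfactor : Algebra.IsCentral ℂ φ.stateCentralizer] {p q : N} (hp : IsStarProjection p)
    (hpB : p ∈ φ.stateCentralizer) (h : ∀ x ∈ φ.stateCentralizer, q * x * p = 0) :
    p = 0 ∨ q = 0 := by
  -- `S` is the unit ball of the right annihilator of `q B`, with `B` the centralizer. Its point
  -- nearest to `1` in `L²` will be central. The multiplications by `1` and `0` fit
  -- `isClosed_weakTopology_mul_mul_eq`.
  let S : Set N := {x | x ∈ φ.stateCentralizer ∧ ‖x‖ ≤ 1} ∩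
    ⋂ b ∈ φ.stateCentralizer, {x | q * b * x * 1 = 0 * x * 0}
  have hS (x) : x ∈ S ↔ (x ∈ φ.stateCentralizer ∧ ‖x‖ ≤ 1) ∧
      ∀ b ∈ φ.stateCentralizer, q * b * x = 0 := by
    simp only [S, Set.mem_inter_iff, Set.mem_ofPred_eq, Set.mem_iInter, mul_one, zero_mul]
  have hScompact : @IsCompact N N.weakTopology S := by
    let _ := N.weakTopology
    exact (isCompact_weakTopology_centralizer hφn).inter_right
      (isClosed_biInter fun b _ ↦ isClosed_weakTopology_mul_mul_eq _ _ _ _)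
  have hpS : p ∈ S := (hS p).2 ⟨⟨hpB, hp.norm_le⟩, h⟩
  have hlsc : @LowerSemicontinuousOn N ℝ N.weakTopology _ (fun x ↦ ‖φ.toGNS (1 - x)‖ ^ 2) S := by
    let _ := N.weakTopology
    exact (lowerSemicontinuousOn_weakTopology hφn).mono fun x hx ↦ ((hS x).1 hx).1.2
  obtain ⟨z, hzS, hzmin⟩ : ∃ z ∈ S, IsMinOn (fun x ↦ ‖φ.toGNS (1 - x)‖ ^ 2) S z := by
    let _ := N.weakTopology
    exact LowerSemicontinuousOn.exists_isMinOn ⟨p, hpS⟩ hScompact hlsc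
  have hmin (x) (hx : x ∈ S) : ‖φ.toGNS (1 - z)‖ ≤ ‖φ.toGNS (1 - x)‖ :=
    le_of_sq_le_sq (hzmin hx) (norm_nonneg _)
  have huniq (y) (hy : y ∈ S) (hyz : ‖φ.toGNS (1 - y)‖ ≤ ‖φ.toGNS (1 - z)‖) : z = y := by
    rw [hS] at hy
    have hz := (hS z).1 hzS
    have hmid : (1 / 2 : ℂ) • (z + y) ∈ S := by
      refine (hS _).2 ⟨⟨Subalgebra.smul_mem _ (add_mem hz.1.1 hy.1.1) _, ?_⟩, fun b hb ↦ ?_⟩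
      · have h₁ : ‖(1 / 2 : ℂ)‖ = 1 / 2 := by norm_num
        rw [norm_smul, h₁]
        linarith [norm_add_le z y, hz.1.2, hy.1.2]
      · rw [mul_smul_comm, mul_add, hz.2 b hb, hy.2 b hb, add_zero, smul_zero]
    have hm := hmin _ hmid
    have heq : φ.toGNS (1 - (1 / 2 : ℂ) • (z + y)) =
        (1 / 2 : ℝ) • (φ.toGNS (1 - z) + φ.toGNS (1 - y)) := by
      rw [← Complex.coe_smul, ← map_add, ← map_smul]
      congr 1
      push_cast
      module
    rw [heq] at hm
    have := sub_eq_zero.2 (eq_of_norm_le_norm_midpoint hyz hm)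
    rw [← map_sub, PositiveLinearMap.toGNS_eq_zero_iff hφ] at this
    exact (sub_eq_zero.1 (by simpa using this)).symm
  have hz := (hS z).1 hzS
  -- Conjugation by `u` preserves `S` and the distance to `1`, so uniqueness makes it fix `z`.
  have hcomm (u) (hu : u ∈ φ.stateCentralizer) (hu' : u ∈ unitary N) : Commute z u := by
    have hu'' := Unitary.mem_iff.1 hu'
    have hmem : u * z * star u ∈ S := by
      refine (hS _).2 ⟨⟨mul_mem (mul_mem hu hz.1.1) (star_mem hu), ?_⟩, fun b hb ↦ ?_⟩
      · rw [CStarRing.norm_mul_mem_unitary _ (Unitary.star_mem hu'),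
          CStarRing.norm_mem_unitary_mul _ hu']
        exact hz.1.2
      · rw [← mul_assoc, ← mul_assoc, mul_assoc q, hz.2 _ (mul_mem hb hu), zero_mul]
    have h1 : 1 - u * z * star u = u * (1 - z) * star u := by
      rw [mul_sub, sub_mul, mul_one, hu''.2]
    have := huniq _ hmem (by rw [h1, PositiveLinearMap.norm_toGNS_conj hu hu'])
    calc z * u = u * z * star u * u := by rw [← this]
      _ = u * z := by rw [mul_assoc, hu''.1, mul_one]
  have hzc : (⟨z, hz.1.1⟩ : φ.stateCentralizer) ∈ Subalgebra.center ℂ φ.stateCentralizer := by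
    rw [Subalgebra.mem_center_iff]
    intro b
    exact Subtype.ext (PositiveLinearMap.commute_of_forall_unitary hcomm b.2).eq.symm
  obtain ⟨c, hc⟩ := Algebra.mem_bot.1 (hfactor.out hzc)
  have hzc' : z = c • (1 : N) := by
    have := congrArg Subtype.val hc
    rw [Algebra.algebraMap_eq_smul_one] at this
    exact this.symm
  -- If `z = 0`, then `1 - p` is no shorter than `1`, and Pythagoras gives `p = 0`. If `c ≠ 0`, then
  -- `q z = 0` gives `q = 0`.
  by_cases hc0 : c = 0
  · left
    rw [hc0, zero_smul] at hzc'
    have h₁ := hmin p hpS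
    rw [hzc', sub_zero] at h₁
    have h₂ : ⟪φ.toGNS (1 - p), φ.toGNS p⟫_ℂ = 0 := by
      rw [φ.inner_toGNS, hp.one_sub.isSelfAdjoint.star_eq, sub_mul, one_mul,
        hp.isIdempotentElem.eq, sub_self, map_zero]
    have h₃ := norm_add_sq_eq_norm_sq_add_norm_sq_of_inner_eq_zero _ _ h₂
    rw [← map_add, sub_add_cancel] at h₃
    rw [← PositiveLinearMap.toGNS_eq_zero_iff hφ, ← norm_eq_zero]
    nlinarith [norm_nonneg (φ.toGNS p), norm_nonneg (φ.toGNS 1), norm_nonneg (φ.toGNS (1 - p))]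
  · right
    have := hz.2 1 (one_mem _)
    rw [hzc', mul_one, mul_smul_comm, mul_one] at this
    exact (smul_eq_zero.1 this).resolve_left hc0

end VonNeumannAlgebra

/-! ### Norm estimates for perturbing a contraction. -/

section Contractions

lemma norm_sub_half_smul_sub_le_one {A : Type*} [CStarAlgebra A] {v : A} (hv : ‖v‖ ≤ 1) :
    ‖v - (1 / 2 : ℝ) • (v - v * (star v * v))‖ ≤ 1 := by
  have hx : v - (1 / 2 : ℝ) • (v - v * (star v * v)) =
      (1 / 2 : ℝ) • (v + v * (star v * v)) := by module
  have h1 : ‖v * (star v * v)‖ ≤ 1 := by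
    refine (norm_mul_le _ _).trans ?_
    rw [CStarRing.norm_star_mul_self]
    have := norm_nonneg v
    nlinarith [mul_nonneg this this]
  have h2 : ‖(1 / 2 : ℝ)‖ = 1 / 2 := by norm_num
  rw [hx, norm_smul, h2]
  linarith [norm_add_le v (v * (star v * v))]

variable {A : Type*} [CStarAlgebra A] [PartialOrder A] [StarOrderedRing A]

/-- With `a = v* v` and `w = 1 - a ≥ 0`, the element is `v (3 - a) / 2`, and `4 - a (3 - a)² = 3 w²
+ w³ ≥ 0`. -/
lemma norm_add_half_smul_sub_le_one {v : A} (hv : ‖v‖ ≤ 1) :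
    ‖v + (1 / 2 : ℝ) • (v - v * (star v * v))‖ ≤ 1 := by
  set a := star v * v with ha
  have ha1 : a ≤ 1 := star_mul_self_le_one hv
  have hsa : star a = a := by rw [ha, star_mul, star_star]
  have hx : v + (1 / 2 : ℝ) • (v - v * a) = (1 / 2 : ℝ) • (v * (3 - a)) := by
    have h3 : v * 3 = (3 : ℝ) • v := by
      rw [ofNat_smul_eq_nsmul ℝ, nsmul_eq_mul]
      exact (Nat.cast_commute 3 v).eq.symm
    rw [mul_sub, h3]
    module
  have hstar : star ((1 / 2 : ℝ) • (v * (3 - a))) * ((1 / 2 : ℝ) • (v * (3 - a))) =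
      (1 / 4 : ℝ) • ((3 - a) * a * (3 - a)) := by
    rw [star_smul, star_mul, star_sub, hsa, star_ofNat, smul_mul_smul_comm, star_trivial]
    norm_num
    rw [ha]
    noncomm_ring
  have hpoly : (3 - a) * a * (3 - a) =
      4 - ((1 - a) * (1 - a) + (1 - a) * (1 - a) + (1 - a) * (1 - a) +
        (1 - a) * (1 - a) * (1 - a)) := by
    have h4 : (4 : A) = 1 + 1 + 1 + 1 := by norm_num
    rw [h4]
    noncomm_ring
  have hw : 0 ≤ 1 - a := sub_nonneg.2 ha1
  have hws : star (1 - a) = 1 - a := by rw [star_sub, star_one, hsa]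
  have hw2 : 0 ≤ (1 - a) * (1 - a) := by
    have := star_mul_self_nonneg (1 - a)
    rwa [hws] at this
  have hw3 : 0 ≤ (1 - a) * (1 - a) * (1 - a) := by
    have := star_left_conjugate_nonneg hw (1 - a)
    rwa [hws] at this
  rw [hx]
  refine norm_le_one_of_star_mul_self_le_one ?_
  rw [hstar, hpoly]
  have h4 : (1 : A) = (1 / 4 : ℝ) • 4 := by
    rw [← map_ofNat (algebraMap ℝ A) 4, Algebra.algebraMap_eq_smul_one, smul_smul]
    norm_num
  calc _ ≤ (1 / 4 : ℝ) • (4 : A) := by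
        refine smul_le_smul_of_nonneg_left ?_ (by norm_num)
        exact sub_le_self _ (add_nonneg (add_nonneg (add_nonneg hw2 hw2) hw2) hw3)
    _ = 1 := h4.symm

/-- Here `v` is a partial isometry, and `t` has orthogonal range and vanishes on its initial space.
So the squares add up, with `t* t ≤ 1 - v* v`. -/
lemma norm_add_le_one_of_star_mul_eq_zero {v t : A} (hv : v * (star v * v) = v) (ht : ‖t‖ ≤ 1)
    (h₁ : star v * t = 0) (h₂ : t * (star v * v) = 0) : ‖v + t‖ ≤ 1 := by
  refine norm_le_one_of_star_mul_self_le_one ?_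
  have h₃ : star t * v = 0 := by
    have := congrArg star h₁
    rwa [star_mul, star_star, star_zero] at this
  have hw : star (1 - star v * v) = 1 - star v * v := by
    rw [star_sub, star_one, star_mul, star_star]
  have hw2 : (1 - star v * v) * (1 - star v * v) = 1 - star v * v := by
    rw [mul_sub, mul_one, sub_mul, one_mul, mul_assoc (star v), hv]
    abel
  have h₄ : star t * t ≤ 1 - star v * v := by
    have hle := star_left_conjugate_le_conjugate (star_mul_self_le_one ht) (1 - star v * v)
    rw [mul_one, hw, hw2] at hle
    refine le_of_eq_of_le ?_ hle
    have h₅ : star v * v * star t = 0 := by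
      have := congrArg star h₂
      rwa [star_mul, star_mul, star_star, star_zero] at this
    rw [sub_mul, one_mul, ← mul_assoc (star v * v), h₅, zero_mul, sub_zero, mul_sub, mul_one,
      mul_assoc, h₂, mul_zero, sub_zero]
  calc star (v + t) * (v + t) = star v * v + star t * t := by
        rw [star_add, add_mul, mul_add, mul_add, h₁, h₃]
        abel
    _ ≤ star v * v + (1 - star v * v) := add_le_add_right h₄ _
    _ = 1 := by abel

end Contractions

/-! ### Equivalence of projections of equal state. -/

namespace VonNeumannAlgebra

variable {H : Type*} [NormedAddCommGroup H] [InnerProductSpace ℂ H] [CompleteSpace H]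
  {N : VonNeumannAlgebra H} {φ : N →ₚ[ℂ] ℂ}

/-- A maximal partial isometry between two projections of the centralizer. -/
lemma exists_partialIsometry_stateCentralizer (hφn : IsNormal φ) {p q : N}
    (hp : IsStarProjection p) (hq : IsStarProjection q) :
    ∃ v ∈ φ.stateCentralizer, q * v = v ∧ v * p = v ∧ v * (star v * v) = v ∧
      (p ∈ φ.stateCentralizer → q ∈ φ.stateCentralizer →
        ∀ x ∈ φ.stateCentralizer, (q - v * star v) * x * (p - star v * v) = 0) := by
  let S : Set N := {x | x ∈ φ.stateCentralizer ∧ ‖x‖ ≤ 1} ∩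
    ({x | q * x * 1 = 1 * x * 1} ∩ {x | 1 * x * p = 1 * x * 1})
  have hS (x) : x ∈ S ↔ (x ∈ φ.stateCentralizer ∧ ‖x‖ ≤ 1) ∧ q * x = x ∧ x * p = x := by
    simp only [S, Set.mem_inter_iff, Set.mem_ofPred_eq, mul_one, one_mul]
  have hScompact : @IsCompact N N.weakTopology S := by
    let _ := N.weakTopology
    exact (isCompact_weakTopology_centralizer hφn).inter_right
      ((isClosed_weakTopology_mul_mul_eq _ _ _ _).inter (isClosed_weakTopology_mul_mul_eq _ _ _ _))
  obtain ⟨v, hv⟩ := exists_extremePoints_weakTopology hScompact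
    ⟨0, (hS 0).2 ⟨⟨zero_mem _, by simp⟩, mul_zero _, zero_mul _⟩⟩
  obtain ⟨⟨hvB, hv1⟩, hqv, hvp⟩ := (hS v).1 (extremePoints_subset hv)
  have hsmul (r : ℝ) {x : N} (hx : x ∈ φ.stateCentralizer) : r • x ∈ φ.stateCentralizer :=
    Subalgebra.smul_mem _ hx (r : ℂ)
  have hpi : v * (star v * v) = v := by
    -- An extreme point `v` is a partial isometry: otherwise it is the midpoint of `v ± (v - v v* v)
    -- / 2`, both in `S`.
    have hd : (1 / 2 : ℝ) • (v - v * (star v * v)) = 0 := by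
      have hdB : (1 / 2 : ℝ) • (v - v * (star v * v)) ∈ φ.stateCentralizer :=
        hsmul _ (sub_mem hvB (mul_mem hvB (mul_mem (star_mem hvB) hvB)))
      have hqd : q * ((1 / 2 : ℝ) • (v - v * (star v * v))) =
          (1 / 2 : ℝ) • (v - v * (star v * v)) := by
        rw [mul_smul_comm, mul_sub, ← mul_assoc q v, hqv]
      have hdp : ((1 / 2 : ℝ) • (v - v * (star v * v))) * p =
          (1 / 2 : ℝ) • (v - v * (star v * v)) := by
        rw [smul_mul_assoc, sub_mul, mul_assoc v, mul_assoc (star v), hvp]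
      refine eq_zero_of_add_sub_mem_of_mem_extremePoints hv ((hS _).2 ⟨⟨add_mem hvB hdB,
        norm_add_half_smul_sub_le_one hv1⟩, ?_, ?_⟩) ((hS _).2 ⟨⟨sub_mem hvB hdB,
        norm_sub_half_smul_sub_le_one hv1⟩, ?_, ?_⟩)
      · rw [mul_add, hqv, hqd]
      · rw [add_mul, hvp, hdp]
      · rw [mul_sub, hqv, hqd]
      · rw [sub_mul, hvp, hdp]
    exact (sub_eq_zero.1 ((smul_eq_zero.1 hd).resolve_left (by norm_num))).symm
  refine ⟨v, hvB, hqv, hvp, hpi, fun hpB hqB x hx ↦ ?_⟩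
  by_contra hy
  set y := (q - v * star v) * x * (p - star v * v) with hydef
  have hyB : y ∈ φ.stateCentralizer :=
    mul_mem (mul_mem (sub_mem hqB (mul_mem hvB (star_mem hvB))) hx)
    (sub_mem hpB (mul_mem (star_mem hvB) hvB))
  have hsq : star v * q = star v := by
    have := congrArg star hqv
    rwa [star_mul, hq.isSelfAdjoint.star_eq] at this
  have hpv : p * star v = star v := by
    have := congrArg star hvp
    rwa [star_mul, hp.isSelfAdjoint.star_eq] at this
  have hpi' : star v * (v * star v) = star v := by
    have := congrArg star hpi
    rwa [star_mul, star_mul, star_star, mul_assoc] at this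
  have hl : star v * (q - v * star v) = 0 := by rw [mul_sub, hsq, hpi', sub_self]
  have hr : (p - star v * v) * (star v * v) = 0 := by
    rw [sub_mul, ← mul_assoc p, hpv, mul_assoc (star v), hpi, sub_self]
  have hql : q * (q - v * star v) = q - v * star v := by
    rw [mul_sub, hq.isIdempotentElem.eq, ← mul_assoc q, hqv]
  have hpr : (p - star v * v) * p = p - star v * v := by
    rw [sub_mul, hp.isIdempotentElem.eq, mul_assoc (star v), hvp]
  have h₁ : star v * y = 0 := by
    rw [hydef, mul_assoc _ x, ← mul_assoc (star v), hl, zero_mul]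
  have h₂ : y * (star v * v) = 0 := by rw [hydef, mul_assoc, hr, mul_zero]
  have hqy : q * y = y := by rw [hydef, mul_assoc _ x, ← mul_assoc q, hql]
  have hyp : y * p = y := by rw [hydef, mul_assoc, hpr]
  -- A nonzero `y` between the leftover projections, normalised, would make `v` the midpoint of `v ±
  -- y / ‖y‖` in `S`.
  have hn : ‖‖y‖⁻¹ • y‖ ≤ 1 := by
    rw [norm_smul, norm_inv, norm_norm, inv_mul_cancel₀ (norm_ne_zero_iff.2 hy)]
  have ht₁ (c : ℝ) : star v * (c • y) = 0 := by rw [mul_smul_comm, h₁, smul_zero]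
  have ht₂ (c : ℝ) : (c • y) * (star v * v) = 0 := by rw [smul_mul_assoc, h₂, smul_zero]
  have hmem (c : ℝ) (hc : ‖c • y‖ ≤ 1) : v + c • y ∈ S := by
    refine (hS _).2 ⟨⟨add_mem hvB (hsmul _ hyB),
      norm_add_le_one_of_star_mul_eq_zero hpi hc (ht₁ c) (ht₂ c)⟩, ?_, ?_⟩
    · rw [mul_add, hqv, mul_smul_comm, hqy]
    · rw [add_mul, hvp, smul_mul_assoc, hyp]
  have hz := eq_zero_of_add_sub_mem_of_mem_extremePoints hv (hmem _ hn) (by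
    rw [sub_eq_add_neg, ← neg_smul]
    exact hmem _ (by rwa [neg_smul, norm_neg]))
  exact hy ((smul_eq_zero.1 hz).resolve_left (inv_ne_zero (norm_ne_zero_iff.2 hy)))

/-- Projections of equal state in a factorial centralizer are equivalent. -/
theorem exists_star_mul_self_eq_of_apply_eq (hφ : IsFaithfulState φ) (hφn : IsNormal φ)
    [Algebra.IsCentral ℂ φ.stateCentralizer] {p q : N} (hp : IsStarProjection p)
    (hq : IsStarProjection q) (hpB : p ∈ φ.stateCentralizer) (hqB : q ∈ φ.stateCentralizer)
    (hpq : φ p = φ q) : ∃ v ∈ φ.stateCentralizer, star v * v = p ∧ v * star v = q := by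
  obtain ⟨v, hvB, hqv, hvp, hpi, hv⟩ := exists_partialIsometry_stateCentralizer hφn hp hq
  have hsq : star v * q = star v := by
    have := congrArg star hqv
    rwa [star_mul, hq.isSelfAdjoint.star_eq] at this
  have hpv : p * star v = star v := by
    have := congrArg star hvp
    rwa [star_mul, hp.isSelfAdjoint.star_eq] at this
  have hP : IsStarProjection (p - star v * v) := by
    refine ⟨?_, ?_⟩
    · rw [IsIdempotentElem, mul_sub, sub_mul, sub_mul, hp.isIdempotentElem.eq, mul_assoc (star v),
        hvp, ← mul_assoc p, hpv, mul_assoc (star v), hpi, sub_self, sub_zero]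
    · rw [IsSelfAdjoint, star_sub, star_mul, star_star, hp.isSelfAdjoint.star_eq]
  have hQ : IsStarProjection (q - v * star v) := by
    refine ⟨?_, ?_⟩
    · rw [IsIdempotentElem, mul_sub, sub_mul, sub_mul, hq.isIdempotentElem.eq, mul_assoc v,
        hsq, ← mul_assoc q, hqv, ← mul_assoc (v * star v), mul_assoc v (star v) v, hpi, sub_self,
        sub_zero]
    · rw [IsSelfAdjoint, star_sub, star_mul, star_star, hq.isSelfAdjoint.star_eq]
  -- `φ` is a trace on the centralizer, so both leftovers have the same state; once one of them
  -- vanishes, faithfulness kills the other.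
  have hφeq : φ (p - star v * v) = φ (q - v * star v) := by
    rw [map_sub, map_sub, hpq, hvB (star v)]
  have hzero {r : N} (hr : IsStarProjection r) (h : φ r = 0) : r = 0 :=
    hφ.faithful r (by rwa [hr.isSelfAdjoint.star_eq, hr.isIdempotentElem.eq])
  have hboth : p - star v * v = 0 ∧ q - v * star v = 0 := by
    rcases eq_zero_or_eq_zero_of_forall_mul_mul_eq_zero hφ hφn hP
      (sub_mem hpB (mul_mem (star_mem hvB) hvB)) (hv hpB hqB) with h | h
    · exact ⟨h, hzero hQ (by rw [← hφeq, h, map_zero])⟩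
    · exact ⟨hzero hP (by rw [hφeq, h, map_zero]), h⟩
  exact ⟨v, hvB, (sub_eq_zero.1 hboth.1).symm, (sub_eq_zero.1 hboth.2).symm⟩

end VonNeumannAlgebra

/-! ### Modular embeddings of matrix algebras -/

section MatrixUnits

/-- A functional on matrices is diagonal in a suitable orthonormal basis. -/
lemma Matrix.exists_matrixUnits_diagonalizing {n : ℕ} (f : Matrix (Fin n) (Fin n) ℂ →ₗ[ℂ] ℂ)
    (hf : ∀ x, f (star x) = star (f x)) :
    ∃ (F : Fin n → Fin n → Matrix (Fin n) (Fin n) ℂ) (l : Fin n → ℂ),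
      (∀ i j, F i j ≠ 0) ∧ (∀ i j, star (F i j) = F j i) ∧ (∀ i j k, F i j * F j k = F i k) ∧
      (∀ i j k m, j ≠ k → F i j * F k m = 0) ∧ ∑ i, F i i = 1 ∧
      (∀ x, ∃ c : Fin n → Fin n → ℂ, x = ∑ i, ∑ j, c i j • F i j) ∧
      (∀ i, f (F i i) = l i) ∧ ∀ i j y, l j * f (F i j * y) = l i * f (y * F i j) := by
  -- The density matrix of `f`, that is `f x = Tr (h x)`; hence the transposed indices.
  let h : Matrix (Fin n) (Fin n) ℂ := .of fun i j ↦ f (.single j i 1)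
  have hfh (x) : f x = (h * x).trace := by
    conv_lhs => rw [Matrix.matrix_eq_sum_single x]
    simp only [map_sum, Matrix.trace, Matrix.diag_apply, Matrix.mul_apply]
    rw [Finset.sum_comm]
    refine Finset.sum_congr rfl fun i _ ↦ Finset.sum_congr rfl fun j _ ↦ ?_
    rw [← mul_one (x j i), ← smul_eq_mul (x j i), ← Matrix.smul_single, map_smul, smul_eq_mul,
      smul_eq_mul, mul_one, mul_comm]
    rfl
  have hherm : h.IsHermitian := by
    ext i j
    change star (f (.single i j 1)) = f (.single j i 1)
    rw [← hf, Matrix.star_eq_conjTranspose, Matrix.conjTranspose_single, star_one]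
  let U : Matrix (Fin n) (Fin n) ℂ := hherm.eigenvectorUnitary
  let l : Fin n → ℂ := fun i ↦ hherm.eigenvalues i
  have hU₁ : star U * U = 1 := (Unitary.mem_iff.1 hherm.eigenvectorUnitary.2).1
  have hU₂ : U * star U = 1 := (Unitary.mem_iff.1 hherm.eigenvectorUnitary.2).2
  have hspec : h = U * Matrix.diagonal l * star U := hherm.spectral_theorem
  let F (i j : Fin n) : Matrix (Fin n) (Fin n) ℂ := U * .single i j 1 * star U
  have hconj (a b : Matrix (Fin n) (Fin n) ℂ) :
      (U * a * star U) * (U * b * star U) = U * (a * b) * star U := by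
    calc _ = U * a * (star U * U) * b * star U := by noncomm_ring
      _ = _ := by rw [hU₁]; noncomm_ring
  have hl (i j) : h * F i j = l i • F i j := by
    rw [hspec, hconj]
    have : Matrix.diagonal l * .single i j 1 = l i • (Matrix.single i j 1 : Matrix _ _ ℂ) := by
      ext a b
      simp only [Matrix.diagonal_mul, Matrix.single_apply, Matrix.smul_apply, smul_eq_mul]
      by_cases h : i = a ∧ j = b <;> simp [h]
    rw [this, Matrix.mul_smul, Matrix.smul_mul]
  have hr (i j) : F i j * h = l j • F i j := by
    rw [hspec, hconj]
    have : .single i j 1 * Matrix.diagonal l = l j • (Matrix.single i j 1 : Matrix _ _ ℂ) := by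
      ext a b
      simp only [Matrix.mul_diagonal, Matrix.single_apply, Matrix.smul_apply, smul_eq_mul]
      by_cases h : i = a ∧ j = b <;> simp [h]
    rw [this, Matrix.mul_smul, Matrix.smul_mul]
  have htr (i) : (F i i).trace = 1 := by
    rw [Matrix.trace_mul_comm, ← mul_assoc, hU₁, one_mul, Matrix.trace_single_eq_same]
  have hFF (i j k) : F i j * F j k = F i k := by
    rw [hconj, Matrix.single_mul_single_same, one_mul]
  refine ⟨F, l, fun i j h0 ↦ ?_, fun i j ↦ ?_, hFF, fun i j k m hjk ↦ ?_, ?_, fun x ↦ ?_,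
    fun i ↦ ?_, fun i j y ↦ ?_⟩
  · have := htr i
    rw [← hFF i j i, h0, zero_mul, Matrix.trace_zero] at this
    exact zero_ne_one this
  · simp only [F, star_mul, Matrix.star_eq_conjTranspose, Matrix.conjTranspose_single,
      star_one, mul_assoc, Matrix.conjTranspose_conjTranspose]
  · rw [hconj, Matrix.single_mul_single_of_ne _ _ _ _ hjk, mul_zero, zero_mul]
  · rw [← Finset.sum_mul, ← Finset.mul_sum, Matrix.sum_single_one, mul_one, hU₂]
  · refine ⟨fun i j ↦ (star U * x * U) i j, ?_⟩
    have hx : x = U * (star U * x * U) * star U := by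
      calc x = (U * star U) * x * (U * star U) := by rw [hU₂, one_mul, mul_one]
        _ = _ := by noncomm_ring
    conv_lhs => rw [hx, Matrix.matrix_eq_sum_single (star U * x * U)]
    simp only [Finset.mul_sum, Finset.sum_mul]
    refine Finset.sum_congr rfl fun i _ ↦ Finset.sum_congr rfl fun j _ ↦ ?_
    simp only [F]
    rw [← Matrix.smul_mul, ← Matrix.mul_smul, Matrix.smul_single, smul_eq_mul, mul_one]
  · rw [hfh, hl, Matrix.trace_smul, htr, smul_eq_mul, mul_one]
  -- Since `h F i j = l i F i j` and `F i j h = l j F i j`, both sides are `l i l j Tr (F i j y)`.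
  · rw [hfh, hfh, ← mul_assoc, hl, Matrix.smul_mul, Matrix.trace_smul, ← mul_assoc,
      Matrix.trace_mul_comm (h * y), ← mul_assoc, hr, Matrix.smul_mul, Matrix.trace_smul]
    simp only [smul_eq_mul]
    ring

end MatrixUnits

/-- Modular invariance places the twist of `ρ a` in the range, as `ρ g`. There `ω` determines it: `c
g = d a`, since `ω` is faithful. The relation thus extends from matrices to every `y`. -/
lemma IsModularEmbedding.mul_apply_mul_eq {A : Type*} [CStarAlgebra A] [PartialOrder A]
    [StarOrderedRing A] {n : ℕ} {ω : Matrix (Fin n) (Fin n) ℂ →ₚ[ℂ] ℂ} {φ : A →ₚ[ℂ] ℂ}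
    {ρ : Matrix (Fin n) (Fin n) ℂ →⋆ₐ[ℂ] A} (hρ : IsModularEmbedding ω φ ρ)
    (hω : IsFaithfulState ω) (hφ : φ.IsCommutantCyclic) {a : Matrix (Fin n) (Fin n) ℂ} {c d : ℂ}
    (ha : ∀ m, c * ω (a * m) = d * ω (m * a)) (y : A) :
    c * φ (ρ a * y) = d * φ (y * ρ a) := by
  have hinv : φ.IsModularInvariant (LinearMap.range ρ.toAlgHom.toLinearMap : Set A) :=
    hρ.modular_invariant
  obtain ⟨_, ⟨g, rfl⟩, hg⟩ := PositiveLinearMap.exists_apply_mul_eq_of_isModularInvariant hφ _ hinv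
    (z := ρ a) ⟨a, rfl⟩
  change ∀ y, φ (ρ a * y) = φ (y * ρ g) at hg
  have hm (m) : ω (a * m) = ω (m * g) := by
    rw [← hρ.state_preserving, ← hρ.state_preserving, map_mul ρ, map_mul ρ, hg]
  have hga : c • g - d • a = 0 := by
    refine hω.faithful _ ?_
    rw [mul_sub, mul_smul_comm, mul_smul_comm, map_sub, map_smul, map_smul, smul_eq_mul,
      smul_eq_mul, ← hm, ha, sub_self]
  have hga' := congrArg (fun m ↦ φ (y * ρ m)) (sub_eq_zero.1 hga)
  simp only [map_smul, mul_smul_comm, smul_eq_mul] at hga'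
  rw [hg, hga']

/-- The unitary that intertwines two systems of matrix units with equivalent corners. -/
lemma exists_unitary_of_matrixUnits {A ι : Type*} [Ring A] [StarRing A] [Fintype ι] [DecidableEq ι]
    {F G : ι → ι → A} (i₀ : ι) {v : A}
    (hFs : ∀ i j, star (F i j) = F j i) (hFm : ∀ i j k, F i j * F j k = F i k)
    (hFz : ∀ i j k m, j ≠ k → F i j * F k m = 0) (hF1 : ∑ i, F i i = 1)
    (hGs : ∀ i j, star (G i j) = G j i) (hGm : ∀ i j k, G i j * G j k = G i k)
    (hGz : ∀ i j k m, j ≠ k → G i j * G k m = 0) (hG1 : ∑ i, G i i = 1)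
    (hv : star v * v = F i₀ i₀) (hv' : v * star v = G i₀ i₀) :
    (∑ i, G i i₀ * v * F i₀ i) ∈ unitary A ∧
      ∀ k l, (∑ i, G i i₀ * v * F i₀ i) * F k l = G k l * ∑ i, G i i₀ * v * F i₀ i := by
  have hstar : star (∑ i, G i i₀ * v * F i₀ i) = ∑ i, F i i₀ * star v * G i₀ i := by
    simp only [star_sum, star_mul, hFs, hGs, mul_assoc]
  -- Stated for general systems so that exchanging `F` and `G` and replacing `v` by `v*` gives the
  -- other unitarity relation.
  have key {F G : ι → ι → A} {v : A} (hFm : ∀ i j k, F i j * F j k = F i k)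
      (hFz : ∀ i j k m, j ≠ k → F i j * F k m = 0) (hGm : ∀ i j k, G i j * G j k = G i k)
      (hG1 : ∑ i, G i i = 1) (hv : star v * v = F i₀ i₀) (hv' : v * star v = G i₀ i₀) :
      (∑ i, G i i₀ * v * F i₀ i) * ∑ i, F i i₀ * star v * G i₀ i = 1 := by
    rw [Finset.sum_mul, ← hG1]
    refine Finset.sum_congr rfl fun i _ ↦ ?_
    rw [Finset.mul_sum, Finset.sum_eq_single i]
    · calc G i i₀ * v * F i₀ i * (F i i₀ * star v * G i₀ i)
          = G i i₀ * v * (F i₀ i * F i i₀) * star v * G i₀ i := by noncomm_ring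
        _ = G i i₀ * ((v * star v) * (v * star v)) * G i₀ i := by rw [hFm, ← hv]; noncomm_ring
        _ = G i i := by rw [hv', hGm, hGm, hGm]
    · intro j _ hj
      calc G i i₀ * v * F i₀ i * (F j i₀ * star v * G i₀ j)
          = G i i₀ * v * (F i₀ i * F j i₀) * star v * G i₀ j := by noncomm_ring
        _ = 0 := by rw [hFz _ _ _ _ hj.symm]; simp
    · simp
  refine ⟨Unitary.mem_iff.2 ⟨?_, ?_⟩, fun k l ↦ ?_⟩
  · rw [hstar]
    have := key (v := star v) hGm hGz hFm hF1 (by rwa [star_star]) (by rwa [star_star])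
    rwa [star_star] at this
  · rw [hstar]
    exact key hFm hFz hGm hG1 hv hv'
  · rw [Finset.sum_mul, Finset.mul_sum, Finset.sum_eq_single k, Finset.sum_eq_single l]
    · rw [mul_assoc, hFm, ← mul_assoc, ← mul_assoc, hGm]
    · intro j _ hj
      rw [← mul_assoc, ← mul_assoc, hGz _ _ _ _ hj.symm, zero_mul, zero_mul]
    · simp
    · intro j _ hj
      rw [mul_assoc, hFz _ _ _ _ hj, mul_zero]
    · simp

/-- Two modular embeddings of a matrix algebra with a faithful normal state into a von Neumann
algebra with a faithful normal state, the centralizer of which is a factor, are conjugate by a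
unitary of the centralizer. -/
theorem lemma4p2 {H : Type*} [NormedAddCommGroup H] [InnerProductSpace ℂ H] [CompleteSpace H]
    (N : VonNeumannAlgebra H) (φ : N →ₚ[ℂ] ℂ)
    (hφ : IsFaithfulState φ) (hφ_normal : VonNeumannAlgebra.IsNormal φ)
    (hfactor : Algebra.IsCentral ℂ φ.stateCentralizer)
    (n : ℕ) (ω : Matrix (Fin n) (Fin n) ℂ →ₚ[ℂ] ℂ) (hω : IsFaithfulState ω)
    (ρ₁ ρ₂ : Matrix (Fin n) (Fin n) ℂ →⋆ₐ[ℂ] N)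
    (hρ₁ : IsModularEmbedding ω φ ρ₁) (hρ₂ : IsModularEmbedding ω φ ρ₂) :
    ∃ u ∈ unitary N, u ∈ φ.stateCentralizer ∧
      ∀ x : Matrix (Fin n) (Fin n) ℂ, u * ρ₁ x * star u = ρ₂ x := by
  have hcyc := VonNeumannAlgebra.isCommutantCyclic hφ hφ_normal
  obtain ⟨F, l, hF0, hFs, hFm, hFz, hF1, hspan, hl, hcomm⟩ :=
    Matrix.exists_matrixUnits_diagonalizing ω.toLinearMap fun x ↦ by
      change ω (star x) = star (ω x)
      rw [← hρ₁.state_preserving, ← hρ₁.state_preserving, map_star, map_star]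
  change ∀ i, ω (F i i) = l i at hl
  change ∀ i j y, l j * ω (F i j * y) = l i * ω (y * F i j) at hcomm
  have hl0 (i) : l i ≠ 0 := fun h0 ↦ hF0 i i <| hω.faithful _ <| by rw [hFs, hFm, hl, h0]
  have hn : Nonempty (Fin n) := by
    by_contra hne
    rw [not_nonempty_iff] at hne
    have := hω.map_one
    rw [Subsingleton.elim (1 : Matrix (Fin n) (Fin n) ℂ) 0, map_zero] at this
    exact zero_ne_one this
  obtain ⟨i₀⟩ := hn
  have hmod₁ (i j) (y : N) := hρ₁.mul_apply_mul_eq hω hcyc (hcomm i j) y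
  have hmod₂ (i j) (y : N) := hρ₂.mul_apply_mul_eq hω hcyc (hcomm i j) y
  have hproj (ρ : Matrix (Fin n) (Fin n) ℂ →⋆ₐ[ℂ] N) : IsStarProjection (ρ (F i₀ i₀)) :=
    ⟨by rw [IsIdempotentElem, ← map_mul, hFm], by rw [IsSelfAdjoint, ← map_star, hFs]⟩
  -- For `i = j` the twist is trivial, so cancelling `l i₀ ≠ 0` puts the diagonal projections in the
  -- centralizer.
  obtain ⟨v, hvB, hv, hv'⟩ := VonNeumannAlgebra.exists_star_mul_self_eq_of_apply_eq hφ hφ_normal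
    (hproj ρ₁) (hproj ρ₂) (fun y ↦ mul_left_cancel₀ (hl0 i₀) (hmod₁ i₀ i₀ y))
    (fun y ↦ mul_left_cancel₀ (hl0 i₀) (hmod₂ i₀ i₀ y))
    (by rw [hρ₁.state_preserving, hρ₂.state_preserving])
  obtain ⟨hu, hint⟩ := exists_unitary_of_matrixUnits (F := fun i j ↦ ρ₁ (F i j))
    (G := fun i j ↦ ρ₂ (F i j)) i₀
    (fun i j ↦ by rw [← map_star, hFs]) (fun i j k ↦ by rw [← map_mul, hFm])
    (fun i j k m h ↦ by rw [← map_mul, hFz _ _ _ _ h, map_zero])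
    (by rw [← map_sum, hF1, map_one])
    (fun i j ↦ by rw [← map_star, hFs]) (fun i j k ↦ by rw [← map_mul, hFm])
    (fun i j k m h ↦ by rw [← map_mul, hFz _ _ _ _ h, map_zero])
    (by rw [← map_sum, hF1, map_one]) hv hv'
  refine ⟨_, hu, sum_mem fun i _ y ↦ mul_left_cancel₀ (hl0 i₀) ?_, fun x ↦ ?_⟩
  -- Moving `ρ₂ (F i i₀)` to the right turns the factor `l i₀` into `l i`, and moving `ρ₁ (F i₀ i)`
  -- turns it back.
  · calc l i₀ * φ (ρ₂ (F i i₀) * v * ρ₁ (F i₀ i) * y)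
        = l i₀ * φ (ρ₂ (F i i₀) * (v * ρ₁ (F i₀ i) * y)) := by simp only [mul_assoc]
      _ = l i * φ (v * (ρ₁ (F i₀ i) * y * ρ₂ (F i i₀))) := by
        rw [hmod₂]; simp only [mul_assoc]
      _ = l i * φ (ρ₁ (F i₀ i) * (y * ρ₂ (F i i₀) * v)) := by
        rw [hvB]; simp only [mul_assoc]
      _ = l i₀ * φ (y * (ρ₂ (F i i₀) * v * ρ₁ (F i₀ i))) := by
        rw [hmod₁]; simp only [mul_assoc]
  · obtain ⟨c, rfl⟩ := hspan x
    have hx (u : N) (hu : ∀ k l, u * ρ₁ (F k l) = ρ₂ (F k l) * u) :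
        u * ρ₁ (∑ i, ∑ j, c i j • F i j) = ρ₂ (∑ i, ∑ j, c i j • F i j) * u := by
      simp only [map_sum, map_smul, Finset.mul_sum, Finset.sum_mul, mul_smul_comm, smul_mul_assoc,
        hu]
    rw [hx _ hint, mul_assoc, (Unitary.mem_iff.1 hu).2, mul_one]

end
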